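/- Let $\mathbf{k}$ be a field of characteristic $0$. A Hom-Lie algebra $(\mathfrak g,[\,,],\alpha)$ is a vector space with a skew-symmetric bilinear bracket and a linear map $\alpha$ such that $\alpha[x,y]=[\alpha x,\alpha y]$ and $[\alpha x,[y,z]]+[\alpha y,[z,x]]+[\alpha z,[x,y]]=0$. A representation of it is a vector space $V$ with linear maps $\rho:\mathfrak g\to\mathrm{End}(V)$ and $\beta:V\to V$ such that $\beta(\rho(x)v)=\rho(\alpha x)(\beta v)$ and $\rho(\alpha x)\rho(y)-\rho(\alpha y)\rho(x)=\rho([x,y])\beta$. For vector spaces $U,W$ with linear maps $\gamma:U\to U$, $\delta:W\to W$, and $n\ge 1$, let $C^n(U_\gamma,W_\delta)$ be the space of $n$-linear maps $f:U^{n}\to W$ with $\delta\circ f=f\circ\gamma^{\otimes n}$. Let $\mathbb S_{(a,b)}$ be the set of $(a,b)$-shuffles, i.e. permutations $\sigma$ of $\{1,\dots,a+b\}$ with $\sigma(1)<\dots<\sigma(a)$ and $\sigma(a+1)<\dots<\sigma(a+b)$, extended by $\sigma(j)=j$ for $j>a+b$. For a vector space $\mathfrak h$ with a linear map $\gamma$,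 Balavoine's bracket of $P\in C^m(\mathfrak h_\gamma,\mathfrak h_\gamma)$ and $Q\in C^n(\mathfrak h_\gamma,\mathfrak h_\gamma)$ is $[P,Q]_B=P\diamond Q-(-1)^{(m-1)(n-1)}Q\diamond P\in C^{m+n-1}(\mathfrak h_\gamma,\mathfrak h_\gamma)$, where $$(P\diamond Q)(x_1,\dots,x_{m+n-1})=\sum_{i=1}^m\sum_{\sigma\in\mathbb S_{(i-1,n-1)}}(-1)^{(i-1)(n-1)}(-1)^\sigma P\big(\gamma^{n-1}x_{\sigma(1)},\dots,\gamma^{n-1}x_{\sigma(i-1)},Q(x_{\sigma(i)},\dots,x_{\sigma(i+n-2)},x_{i+n-1}),\gamma^{n-1}x_{i+n},\dots,\gamma^{n-1}x_{m+n-1}\big).$$ **Theorem.** Let $(\mathfrak g,[\,,],\alpha)$ be a Hom-Lie algebra and $(V,\rho,\beta)$ a representation of it. Let $\pi\in C^2((\mathfrak g\oplus V)_{\alpha\oplus\beta},(\mathfrak g\oplus V)_{\alpha\oplus\beta})$ be the hemi-semidirect product bracket $\pi((x,u),(y,v))=([x,y],\rho(x)v)$, and regard $C^n(V_\beta,\mathfrak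 g_\alpha)$ as a subspace of $C^n((\mathfrak g\oplus V)_{\alpha\oplus\beta},(\mathfrak g\oplus V)_{\alpha\oplus\beta})$ by $P\mapsto\big(((x_1,v_1),\dots,(x_n,v_n))\mapsto(P(v_1,\dots,v_n),0)\big)$. Then for $m,n\ge1$, $P\in C^m(V_\beta,\mathfrak g_\alpha)$ and $Q\in C^n(V_\beta,\mathfrak g_\alpha)$, the element $$[\![P,Q]\!]=(-1)^{m-1}[[\pi,P]_B,Q]_B$$ lies in $C^{m+n}(V_\beta,\mathfrak g_\alpha)$, and this bracket makes $C^\bullet(V_\beta,\mathfrak g_\alpha)=\bigoplus_{n\ge1}C^n(V_\beta,\mathfrak g_\alpha)$ a graded Lie algebra: for $P,Q$ of degrees $m,n$ and homogeneous $S$, $$[\![P,Q]\!]=-(-1)^{mn}[\![Q,P]\!],\qquad [\![P,[\![Q,S]\!]]\!]=[\![[\![P,Q]\!],S]\!]+(-1)^{mn}[\![Q,[\![P,S]\!]]\!].$$ Explicitly, for $v_1,\dots,v_{m+n}\in V$, $[\![P,Q]\!](v_1,\dots,v_{m+n})$ equals $$A_{P,Q}-(-1)^{mn}A_{Q,P}+\sum_{\sigma\in\mathbb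 S_{(m,n)}}(-1)^{mn+1}(-1)^\sigma\big[P(\beta^{n-1}v_{\sigma(1)},\dots,\beta^{n-1}v_{\sigma(m)}),\,Q(\beta^{m-1}v_{\sigma(m+1)},\dots,\beta^{m-1}v_{\sigma(m+n)})\big],$$ where $$A_{P,Q}=\sum_{i=1}^m\sum_{\sigma\in\mathbb S_{(i-1,n)}}(-1)^{(i-1)n+1}(-1)^\sigma P\big(\beta^nv_{\sigma(1)},\dots,\beta^nv_{\sigma(i-1)},\rho\big(Q(v_{\sigma(i)},\dots,v_{\sigma(i+n-1)})\big)(\beta^{n-1}v_{i+n}),\beta^nv_{i+n+1},\dots,\beta^nv_{m+n}\big)$$ and $A_{Q,P}$ is the same expression with $(P,m)$ and $(Q,n)$ interchanged. -/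

import Mathlib

open scoped DirectSum

namespace HomLie

/-- A (multiplicative) Hom-Lie algebra structure on a vector space `g`. -/
structure HomLieAlgebra (k g : Type*) [Field k] [AddCommGroup g] [Module k g] where
  bracket : g →ₗ[k] g →ₗ[k] g
  twist : g →ₗ[k] g
  skew : ∀ x y, bracket x y = -bracket y x
  multiplicative : ∀ x y, twist (bracket x y) = bracket (twist x) (twist y)
  hom_jacobi : ∀ x y z,
    bracket (twist x) (bracket y z) + bracket (twist y) (bracket z x)
      + bracket (twist z) (bracket x y) = 0

/-- A representation of a Hom-Lie algebra `L` on a vector space `V`. -/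
structure Representation {k g : Type*} [Field k] [AddCommGroup g] [Module k g]
    (L : HomLieAlgebra k g) (V : Type*) [AddCommGroup V] [Module k V] where
  rho : g →ₗ[k] V →ₗ[k] V
  twist : V →ₗ[k] V
  multiplicative : ∀ x v, twist (rho x v) = rho (L.twist x) (twist v)
  action : ∀ x y v,
    rho (L.twist x) (rho y v) - rho (L.twist y) (rho x v) = rho (L.bracket x y) (twist v)

section Cochains

variable {k U W : Type*} [Field k] [AddCommGroup U] [Module k U] [AddCommGroup W] [Module k W]

/-- `C^n(U_α, W_β)`: the `n`-linear maps `f` from `U` to `W` with `β ∘ f = f ∘ α^{⊗ n}`. -/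
def Cochain (α : U →ₗ[k] U) (β : W →ₗ[k] W) (n : ℕ) :
    Submodule k (MultilinearMap k (fun _ : Fin n => U) W) where
  carrier := {f | ∀ x : Fin n → U, β (f x) = f (fun i => α (x i))}
  add_mem' := by
    intro f g hf hg x
    simp only [Set.mem_ofPred_eq] at hf hg
    simp [hf x, hg x]
  zero_mem' := by
    intro x
    simp
  smul_mem' := by
    intro c f hf x
    simp only [Set.mem_ofPred_eq] at hf
    simp [hf x]

theorem cochain_equivariant {α : U →ₗ[k] U} {β : W →ₗ[k] W} {n : ℕ} (f : Cochain α β n)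
    (x : Fin n → U) : β (f.1 x) = f.1 (fun i => α (x i)) :=
  f.2 x

end Cochains

/-- The `(a, b)`-shuffles, as the permutations of `N` letters (numbered from `0`) that are
increasing on the first `a` letters, increasing on the next `b` letters,
and fix all the letters after these. -/
def shuffles (N a b : ℕ) : Finset (Equiv.Perm (Fin N)) :=
  Finset.univ.filter fun σ =>
    (∀ j l : Fin N, j < l → (l : ℕ) < a → σ j < σ l) ∧
    (∀ j l : Fin N, a ≤ (j : ℕ) → j < l → (l : ℕ) < a + b → σ j < σ l) ∧
    (∀ j : Fin N, a + b ≤ (j : ℕ) → σ j = j)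

section Balavoine

variable {k h : Type*} [Field k] [AddCommGroup h] [Module k h]

/-- The entries of
`(α^{n-1} x_0, …, α^{n-1} x_{i-1}, Q(x_i, …, x_{i+n-1}), α^{n-1} x_{i+n}, …, α^{n-1} x_{m+n-2})`
(everything is numbered from `0`; `N = m + n - 1` is the number of variables). -/
def insertArgs (α : h →ₗ[k] h) {m n N : ℕ} (hN : N + 1 = m + n)
    (Q : MultilinearMap k (fun _ : Fin n => h) h) (i : Fin m) (x : Fin N → h) : Fin m → h :=
  fun j =>
    if hj : j < i then (α ^ (n - 1)) (x ⟨j, by omega⟩)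
    else if hi : j = i then Q (fun l => x ⟨i + l, by omega⟩)
    else (α ^ (n - 1)) (x ⟨j + n - 1, by omega⟩)

theorem insertArgs_update (α : h →ₗ[k] h) {m n N : ℕ} (hN : N + 1 = m + n)
    (Q : MultilinearMap k (fun _ : Fin n => h) h) (i : Fin m) [DecidableEq (Fin N)]
    (x : Fin N → h) (c : Fin N) :
    ∃ (j : Fin m) (φ : h →ₗ[k] h), ∀ v,
      insertArgs α hN Q i (Function.update x c v)
        = Function.update (insertArgs α hN Q i x) j (φ v) := by
  rcases lt_or_ge (c : ℕ) i with h1 | h1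
  · refine ⟨⟨c, by omega⟩, α ^ (n - 1), fun v => ?_⟩
    funext j
    simp only [insertArgs, Function.update_apply, Fin.ext_iff, Fin.lt_def]
    split_ifs <;> first | rfl | omega | skip
    congr 1
    funext l
    rw [if_neg (by omega)]
  · rcases lt_or_ge (c : ℕ) (i + n) with h2 | h2
    · refine ⟨i, Q.toLinearMap (fun l => x ⟨i + l, by omega⟩) ⟨c - i, by omega⟩, fun v => ?_⟩
      funext j
      simp only [insertArgs, Function.update_apply, Fin.ext_iff, Fin.lt_def,
        MultilinearMap.toLinearMap_apply]
      split_ifs <;> first | rfl | omega | skip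
      congr 1
      funext l
      simp only [Function.update_apply, Fin.ext_iff]
      split_ifs <;> first | rfl | omega
    · refine ⟨⟨c + 1 - n, by omega⟩, α ^ (n - 1), fun v => ?_⟩
      funext j
      simp only [insertArgs, Function.update_apply, Fin.ext_iff, Fin.lt_def]
      split_ifs <;> first | rfl | omega | skip
      congr 1
      funext l
      rw [if_neg (by omega)]

/-- The `N = m + n - 1`-linear map
`P(α^{n-1} x_0, …, α^{n-1} x_{i-1}, Q(x_i, …, x_{i+n-1}), α^{n-1} x_{i+n}, …)`. -/
def insertAt (α : h →ₗ[k] h) {m n N : ℕ} (hN : N + 1 = m + n)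
    (P : MultilinearMap k (fun _ : Fin m => h) h) (Q : MultilinearMap k (fun _ : Fin n => h) h)
    (i : Fin m) : MultilinearMap k (fun _ : Fin N => h) h where
  toFun x := P (insertArgs α hN Q i x)
  map_update_add' := by
    intro _ x c a b
    obtain ⟨j, φ, hφ⟩ := insertArgs_update α hN Q i x c
    simp only [hφ, map_add, MultilinearMap.map_update_add]
  map_update_smul' := by
    intro _ x c a b
    obtain ⟨j, φ, hφ⟩ := insertArgs_update α hN Q i x c
    simp only [hφ, map_smul, MultilinearMap.map_update_smul]

/-- The multilinear map underlying `P ⋄ Q`: the signed sum, over `0 ≤ i < m` and over the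
`(i, n-1)`-shuffles `σ` of the variables, of
`P(α^{n-1} x_{σ(0)}, …, α^{n-1} x_{σ(i-1)}, Q(x_{σ(i)}, …, x_{σ(i+n-2)}, x_{i+n-1}),
α^{n-1} x_{i+n}, …, α^{n-1} x_{m+n-2})`. -/
def diamondAux (α : h →ₗ[k] h) {m n N : ℕ} (hN : N + 1 = m + n)
    (P : MultilinearMap k (fun _ : Fin m => h) h) (Q : MultilinearMap k (fun _ : Fin n => h) h) :
    MultilinearMap k (fun _ : Fin N => h) h :=
  ∑ i : Fin m, ∑ σ ∈ shuffles N i (n - 1),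
    ((-1 : ℤˣ) ^ ((i : ℕ) * (n - 1)) * Equiv.Perm.sign σ) •
      (insertAt α hN P Q i).domDomCongr σ

theorem twist_pow_comm (α : h →ₗ[k] h) (r : ℕ) (v : h) : α ((α ^ r) v) = (α ^ r) (α v) := by
  rw [← Module.End.mul_apply, ← Module.End.mul_apply, ← pow_succ', ← pow_succ]

theorem insertAt_equivariant (α : h →ₗ[k] h) {m n N : ℕ} (hN : N + 1 = m + n)
    (P : Cochain α α m) (Q : Cochain α α n) (i : Fin m) (x : Fin N → h) :
    α (insertAt α hN P.1 Q.1 i x) = insertAt α hN P.1 Q.1 i (fun c => α (x c)) := by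
  change α (P.1 _) = P.1 _
  refine (cochain_equivariant P _).trans ?_
  congr 1
  funext j
  simp only [insertArgs]
  split_ifs
  · exact twist_pow_comm α _ _
  · exact cochain_equivariant Q _
  · exact twist_pow_comm α _ _

theorem diamondAux_mem (α : h →ₗ[k] h) {m n N : ℕ} (hN : N + 1 = m + n)
    (P : Cochain α α m) (Q : Cochain α α n) :
    diamondAux α hN P.1 Q.1 ∈ Cochain α α N := by
  refine Submodule.sum_mem _ fun i _ => Submodule.sum_mem _ fun σ _ => ?_
  have key : (insertAt α hN P.1 Q.1 i).domDomCongr σ ∈ Cochain α α N := fun x =>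
    insertAt_equivariant α hN P Q i fun c => x (σ c)
  rcases Int.units_eq_one_or ((-1 : ℤˣ) ^ ((i : ℕ) * (n - 1)) * Equiv.Perm.sign σ) with e | e
  · rw [e, one_smul]
    exact key
  · rw [e, Units.neg_smul, one_smul]
    exact Submodule.neg_mem _ key

/-- `P ⋄ Q ∈ C^{m+n-1}(h_α, h_α)` for `P ∈ C^m(h_α, h_α)` and `Q ∈ C^n(h_α, h_α)`, `m, n ≥ 1`. -/
def diamond (α : h →ₗ[k] h) {m n N : ℕ} (hN : N + 1 = m + n)
    (P : Cochain α α m) (Q : Cochain α α n) : Cochain α α N :=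
  ⟨diamondAux α hN P.1 Q.1, diamondAux_mem α hN P Q⟩

/-- Balavoine's bracket `[P, Q]_B = P ⋄ Q - (-1)^{(m-1)(n-1)} Q ⋄ P`, for `m, n ≥ 1`. -/
def balavoine (α : h →ₗ[k] h) {m n N : ℕ} (hN : N + 1 = m + n)
    (P : Cochain α α m) (Q : Cochain α α n) : Cochain α α N :=
  diamond α hN P Q
    - (-1 : k) ^ ((m - 1) * (n - 1)) • diamond α (hN.trans (Nat.add_comm m n)) Q P

end Balavoine

section Derived

variable {k g V : Type*} [Field k] [AddCommGroup g] [Module k g] [AddCommGroup V] [Module k V]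
  {L : HomLieAlgebra k g}

/-- The twist `α ⊕ β` of `g ⊕ V`. -/
abbrev Representation.sumTwist (R : Representation L V) : (g × V) →ₗ[k] (g × V) :=
  L.twist.prodMap R.twist

/-- The hemi-semidirect product bracket `π((x, u), (y, v)) = ([x, y], ρ(x) v)`, an element of
`C^2((g ⊕ V)_{α ⊕ β}, (g ⊕ V)_{α ⊕ β})`. -/
def Representation.hemi (R : Representation L V) : Cochain R.sumTwist R.sumTwist 2 where
  val :=
    { toFun := fun z => (L.bracket (z 0).1 (z 1).1, R.rho (z 0).1 (z 1).2)
      map_update_add' := by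
        intro _ z c a b
        fin_cases c <;> simp
      map_update_smul' := by
        intro _ z c a b
        fin_cases c <;> simp }
  property := by
    intro z
    exact Prod.ext (L.multiplicative _ _) (R.multiplicative _ _)

/-- The inclusion `C^n(V_β, g_α) ⊆ C^n((g ⊕ V)_{α ⊕ β}, (g ⊕ V)_{α ⊕ β})`, which sends `P` to
`((x_1, v_1), …, (x_n, v_n)) ↦ (P(v_1, …, v_n), 0)`. -/
def Representation.incl (R : Representation L V) {n : ℕ} (P : Cochain R.twist L.twist n) :
    Cochain R.sumTwist R.sumTwist n where
  val := (LinearMap.inl k g V).compMultilinearMap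
    (P.1.compLinearMap fun _ => LinearMap.snd k g V)
  property := by
    intro z
    change (L.twist (P.1 _), R.twist 0) = (P.1 _, 0)
    exact Prod.ext (cochain_equivariant P _) (map_zero _)

/-- The element `(-1)^{m-1} [[π, P]_B, Q]_B` of
`C^{m+n}((g ⊕ V)_{α ⊕ β}, (g ⊕ V)_{α ⊕ β})`. -/
def Representation.derived (R : Representation L V) {m n N : ℕ} (hN : N = m + n)
    (P : Cochain R.twist L.twist m) (Q : Cochain R.twist L.twist n) :
    Cochain R.sumTwist R.sumTwist N :=
  (-1 : k) ^ (m - 1) •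
    balavoine R.sumTwist (m := m + 1) (n := n) (by omega)
      (balavoine R.sumTwist (m := 2) (n := m) (N := m + 1) (by omega) R.hemi (R.incl P))
      (R.incl Q)

/-- The sum, over `0 ≤ i < m` and over the `(i, n)`-shuffles `σ`, of
`(-1)^{in+1} (-1)^σ P(β^n v_{σ(0)}, …, β^n v_{σ(i-1)},
ρ(Q(v_{σ(i)}, …, v_{σ(i+n-1)})) (β^{n-1} v_{i+n}), β^n v_{i+n+1}, …, β^n v_{m+n-1})`. -/
def Representation.halfSum (R : Representation L V) {m n N : ℕ} (hN : N = m + n)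
    (P : Cochain R.twist L.twist m) (Q : Cochain R.twist L.twist n) (v : Fin N → V) : g :=
  ∑ i : Fin m, ∑ σ ∈ shuffles N i n,
    ((-1 : ℤˣ) ^ ((i : ℕ) * n + 1) * Equiv.Perm.sign σ) •
      P.1 (fun j =>
        if j < i then (R.twist ^ n) (v (σ ⟨j, by omega⟩))
        else if j = i then
          R.rho (Q.1 fun l => v (σ ⟨i + l, by omega⟩))
            ((R.twist ^ (n - 1)) (v ⟨i + n, by omega⟩))
        else (R.twist ^ n) (v ⟨j + n, by omega⟩))

/-- The sum, over the `(m, n)`-shuffles `σ`, of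
`(-1)^{mn+1} (-1)^σ [P(β^{n-1} v_{σ(0)}, …, β^{n-1} v_{σ(m-1)}),
Q(β^{m-1} v_{σ(m)}, …, β^{m-1} v_{σ(m+n-1)})]`. -/
def Representation.bracketSum (R : Representation L V) {m n N : ℕ} (hN : N = m + n)
    (P : Cochain R.twist L.twist m) (Q : Cochain R.twist L.twist n) (v : Fin N → V) : g :=
  ∑ σ ∈ shuffles N m n,
    ((-1 : ℤˣ) ^ (m * n + 1) * Equiv.Perm.sign σ) •
      L.bracket (P.1 fun j => (R.twist ^ (n - 1)) (v (σ ⟨j, by omega⟩)))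
        (Q.1 fun l => (R.twist ^ (m - 1)) (v (σ ⟨m + l, by omega⟩)))

end Derived

/-- A graded Lie algebra structure on `⨁_{n ≥ 1} A n`. -/
structure GradedLieAlgebra (k : Type*) [Field k] (A : ℕ+ → Type*)
    [∀ n, AddCommGroup (A n)] [∀ n, Module k (A n)] where
  bracket : (⨁ n, A n) →ₗ[k] (⨁ n, A n) →ₗ[k] ⨁ n, A n
  degree : ∀ (m n : ℕ+) (P : A m) (Q : A n), ∃ S : A (m + n),
    bracket (DirectSum.lof k ℕ+ A m P) (DirectSum.lof k ℕ+ A n Q)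
      = DirectSum.lof k ℕ+ A (m + n) S
  skew : ∀ (m n : ℕ+) (P : A m) (Q : A n),
    bracket (DirectSum.lof k ℕ+ A m P) (DirectSum.lof k ℕ+ A n Q)
      = -((-1 : k) ^ (m * n : ℕ) •
        bracket (DirectSum.lof k ℕ+ A n Q) (DirectSum.lof k ℕ+ A m P))
  jacobi : ∀ (m n r : ℕ+) (P : A m) (Q : A n) (S : A r),
    bracket (DirectSum.lof k ℕ+ A m P)
        (bracket (DirectSum.lof k ℕ+ A n Q) (DirectSum.lof k ℕ+ A r S))
      = bracket (bracket (DirectSum.lof k ℕ+ A m P) (DirectSum.lof k ℕ+ A n Q))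
          (DirectSum.lof k ℕ+ A r S)
        + (-1 : k) ^ (m * n : ℕ) • bracket (DirectSum.lof k ℕ+ A n Q)
          (bracket (DirectSum.lof k ℕ+ A m P) (DirectSum.lof k ℕ+ A r S))

end HomLie

/-! The bracket is a derived bracket: an odd element of square zero, `π`, together with an abelian
subalgebra, `C^•(V_β, g_α)`, of a graded Lie algebra. The graded Jacobi identity of Balavoine's
bracket is not proved directly; everything is transported to an associative algebra.

A cochain `P` of arity `m` acts on multilinear functions `f` of words of arbitrary length: sum all
signed insertions of `P` into the word, twist the letters left over by `γ^{m-1}`, then apply `f`. In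
a composite of two such operators the insertions at disjoint places cancel in the graded commutator,
and the nested ones add up to the insertion of the Balavoine bracket (`ins_ins`, `insOp_balavoine`).
The resulting map `insOp` is linear and injective, and it reverses the order of products. The
translation between sums over shuffles and words is `diamondAux_apply`.

In the operator algebra, `x = insOp π` satisfies `x * x = 0`: the Hom-Jacobi identity and the
representation axiom give `π ⋄ π = 0`, and characteristic 0 removes the factor 2. The operators of
`C^•(V_β, g_α)` commute in the graded sense, since these cochains take values in `g` and read only
`V`. The Jacobi identity of the derived bracket then follows from `x * x = 0` alone
(`derivedComm_jacobi`), and its skew symmetry from graded commutation alone (`derivedComm_skew`).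

Closure is a weight argument. Doubling the vectors of `V` shows that `[[π, P]_B, Q]_B` turns `m + n`
factors 2 on its inputs into none on its output. As its arity is also `m + n`, it reads only `V` and
lands in `g` (`incl_restr`).

For the explicit formula, `P ⋄ Q = Q ⋄ P = 0` leaves three contributions to the double bracket: `(π
⋄ P) ⋄ Q` gives the sum of brackets, `(P ⋄ π) ⋄ Q = P ⋄ [π, Q]_B` gives `A_{P,Q}`, and `Q ⋄ [π,
P]_B` gives `A_{Q,P}`. -/

set_option linter.unusedSectionVars false

namespace HomLie

/-! ### Signed unshuffles of words and the calculus of insertions. -/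

section Words

variable {k h A B : Type*} [Field k] [AddCommGroup h] [Module k h] [AddCommGroup A] [Module k A]
  [AddCommGroup B] [Module k B]

variable (k) in
/-- The signed sum of `G a b` over all ways of splitting the word `X` into two complementary
subwords `a` and `b`. Words are read backwards: the head is the last letter. -/
def unsh : List h → (List h → List h → A) → A
  | [], G => G [] []
  | x :: X, G => unsh X (fun a b => G (x :: a) b)
      + unsh X (fun a b => (-1 : k) ^ a.length • G a (x :: b))

variable (k) in
/-- The sum of all signed insertions of `Q` into `f`, where the letters not consumed by `Q` are
twisted by `q`. -/
def ins (q : h →ₗ[k] h) (Q : List h → h) : List h → (List h → A) → A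
  | [], _ => 0
  | x :: X, f => ins q Q X (fun a => f (q x :: a))
      + unsh k X (fun a b => f (Q (x :: b) :: a.map q))

theorem unsh_congr (X : List h) {G G' : List h → List h → A}
    (H : ∀ a b, a.length + b.length = X.length → G a b = G' a b) :
    unsh k X G = unsh k X G' := by
  induction X generalizing G G' with
  | nil => exact H _ _ rfl
  | cons x X ih =>
    simp only [unsh]
    congr 1
    · exact ih fun a b hab => H _ _ (by simp only [List.length_cons]; omega)
    · exact ih fun a b hab => by rw [H _ _ (by simp only [List.length_cons]; omega)]

theorem unsh_add (X : List h) (G G' : List h → List h → A) :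
    unsh k X (fun a b => G a b + G' a b) = unsh k X G + unsh k X G' := by
  induction X generalizing G G' with
  | nil => rfl
  | cons x X ih => simp only [unsh, smul_add, ih]; abel

theorem unsh_smul (X : List h) (c : k) (G : List h → List h → A) :
    unsh k X (fun a b => c • G a b) = c • unsh k X G := by
  induction X generalizing G with
  | nil => rfl
  | cons x X ih => simp only [unsh, smul_comm _ c, ih, smul_add]

theorem unsh_zero (X : List h) : unsh k X (fun _ _ => (0 : A)) = 0 := by
  induction X with
  | nil => rfl
  | cons x X ih => simp only [unsh, smul_zero, ih, add_zero]

theorem map_unsh (φ : A →ₗ[k] B) (X : List h) (G : List h → List h → A) :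
    φ (unsh k X G) = unsh k X (fun a b => φ (G a b)) := by
  induction X generalizing G with
  | nil => rfl
  | cons x X ih => simp only [unsh, map_add, ih, map_smul]

theorem unsh_map (p : h → h) (X : List h) (G : List h → List h → A) :
    unsh k (X.map p) G = unsh k X (fun a b => G (a.map p) (b.map p)) := by
  induction X generalizing G with
  | nil => rfl
  | cons x X ih => simp only [List.map_cons, unsh, ih, List.length_map]

/-- Both sides split `X` into three subwords, weighted by the sign of rearranging `X` into `c ++ d
++ b`. -/
theorem unsh_coassoc (X : List h) (H : List h → List h → List h → A) :
    unsh k X (fun a b => unsh k a (fun c d => H c d b))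
      = unsh k X (fun c e => unsh k e (fun d b => H c d b)) := by
  induction X generalizing H with
  | nil => rfl
  | cons x X ih =>
    simp only [unsh, unsh_add, smul_add, ← unsh_smul, ih, smul_smul]
    rw [add_assoc]
    congr 2
    rw [← ih fun c d b => ((-1 : k) ^ c.length * (-1 : k) ^ d.length) • H c d (x :: b)]
    refine unsh_congr _ fun a b _ => unsh_congr _ fun c d hcd => ?_
    rw [← hcd, pow_add]

theorem unsh_comm (X : List h) (G : List h → List h → A) :
    unsh k X G = unsh k X (fun a b => (-1 : k) ^ (a.length * b.length) • G b a) := by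
  induction X generalizing G with
  | nil => simp [unsh]
  | cons x X ih =>
    simp only [unsh, List.length_cons]
    rw [add_comm, ih, ih fun a b => G (x :: a) b]
    congr 1
    · refine unsh_congr _ fun a b _ => ?_
      rw [smul_smul, add_mul, pow_add, one_mul]
    · refine unsh_congr _ fun a b _ => ?_
      rw [smul_smul, mul_add, pow_add, mul_one, mul_comm ((-1 : k) ^ (_ * _)), ← mul_assoc,
        ← mul_pow]
      simp

theorem unsh_eq_of_left_nil (X : List h) (G : List h → List h → A)
    (H : ∀ y a b, G (y :: a) b = 0) : unsh k X G = G [] X := by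
  induction X generalizing G with
  | nil => rfl
  | cons x X ih =>
    simp only [unsh, H, unsh_zero, zero_add]
    rw [ih _ fun y a b => by rw [H, smul_zero]]
    simp

/-- A function of words that is linear in every letter. -/
def MultiLin (k : Type*) {h A : Type*} [Field k] [AddCommGroup h] [Module k h] [AddCommGroup A]
    [Module k A] (f : List h → A) : Prop :=
  ∀ X Z, IsLinearMap k (fun v => f (X ++ v :: Z))

namespace MultiLin

variable {f : List h → A}

theorem cons (hf : MultiLin k f) (y : h) : MultiLin k (fun a => f (y :: a)) :=
  fun X Z => hf (y :: X) Z

theorem head (hf : MultiLin k f) (Z : List h) : IsLinearMap k (fun v => f (v :: Z)) :=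
  hf [] Z

theorem head_zero (hf : MultiLin k f) (Z : List h) : f (0 :: Z) = 0 :=
  (hf.head Z).map_zero

theorem map (hf : MultiLin k f) (p : h →ₗ[k] h) : MultiLin k (fun a => f (a.map p)) := by
  intro X Z
  have := hf (X.map p) (Z.map p)
  constructor
  · intro x y
    simpa using this.map_add (p x) (p y)
  · intro c x
    simpa using this.map_smul c (p x)

theorem add {f' : List h → A} (hf : MultiLin k f) (hf' : MultiLin k f') :
    MultiLin k (fun a => f a + f' a) := fun X Z =>
  ⟨fun x y => by simp only [(hf X Z).map_add, (hf' X Z).map_add]; abel,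
    fun c x => by simp only [(hf X Z).map_smul, (hf' X Z).map_smul, smul_add]⟩

theorem smul (hf : MultiLin k f) (c : k) : MultiLin k (fun a => c • f a) := fun X Z =>
  ⟨fun x y => by simp only [(hf X Z).map_add, smul_add],
    fun d x => by simp only [(hf X Z).map_smul, smul_comm d]⟩

theorem length_smul (hf : MultiLin k f) (c : ℕ → k) :
    MultiLin k (fun a => c a.length • f a) := by
  intro X Z
  have e : (fun v => c (X ++ v :: Z).length • f (X ++ v :: Z))
      = fun v => c (X.length + (Z.length + 1)) • f (X ++ v :: Z) := by
    funext v
    simp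
  beta_reduce
  rw [e]
  exact hf.smul _ X Z

theorem zero : MultiLin k (fun _ : List h => (0 : A)) := fun _ _ =>
  ⟨fun _ _ => (add_zero _).symm, fun c _ => (smul_zero c).symm⟩

theorem comp (hf : MultiLin k f) (φ : A →ₗ[k] B) : MultiLin k (fun a => φ (f a)) := fun X Z =>
  ⟨fun x y => by simp only [(hf X Z).map_add, map_add],
    fun c x => by simp only [(hf X Z).map_smul, map_smul]⟩

theorem unsh {G : List h → List h → A} (h₁ : ∀ b, MultiLin k (fun a => G a b))
    (h₂ : ∀ a, MultiLin k (fun b => G a b)) : MultiLin k (fun a => HomLie.unsh k a G) := by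
  intro X Z
  induction X generalizing G with
  | nil =>
    simp only [List.nil_append, HomLie.unsh]
    constructor
    · intro x y
      have e₁ : ∀ a b, G ((x + y) :: a) b = G (x :: a) b + G (y :: a) b :=
        fun a b => ((h₁ b).head a).map_add x y
      have e₂ : ∀ a b, G a ((x + y) :: b) = G a (x :: b) + G a (y :: b) :=
        fun a b => ((h₂ a).head b).map_add x y
      simp only [e₁, e₂, unsh_add, smul_add]
      abel
    · intro c x
      have e₁ : ∀ a b, G ((c • x) :: a) b = c • G (x :: a) b :=
        fun a b => ((h₁ b).head a).map_smul c x
      have e₂ : ∀ a b, G a ((c • x) :: b) = c • G a (x :: b) :=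
        fun a b => ((h₂ a).head b).map_smul c x
      simp only [e₁, e₂, unsh_smul, smul_add, smul_comm _ c]
  | cons y X ih =>
    have i₁ := ih (G := fun a b => G (y :: a) b) (fun b => (h₁ b).cons y) (fun a => h₂ (y :: a))
    have i₂ := ih (G := fun a b => (-1 : k) ^ a.length • G a (y :: b))
      (fun b => (h₁ _).length_smul fun n => (-1) ^ n) (fun a => ((h₂ a).cons y).smul _)
    simp only [List.cons_append, HomLie.unsh]
    exact (i₁.mk' _ + i₂.mk' _).isLinear

end MultiLin

variable (q : h →ₗ[k] h) (Q : List h → h)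

theorem ins_add (X : List h) (f f' : List h → A) :
    ins k q Q X (fun a => f a + f' a) = ins k q Q X f + ins k q Q X f' := by
  induction X generalizing f f' with
  | nil => simp [ins]
  | cons x X ih => simp only [ins, ih, unsh_add]; abel

theorem ins_smul (X : List h) (c : k) (f : List h → A) :
    ins k q Q X (fun a => c • f a) = c • ins k q Q X f := by
  induction X generalizing f with
  | nil => simp [ins]
  | cons x X ih => simp only [ins, ih, unsh_smul, smul_add]

theorem ins_zero (X : List h) : ins k q Q X (fun _ => (0 : A)) = 0 := by
  induction X with
  | nil => rfl
  | cons x X ih => simp only [ins, ih, unsh_zero, add_zero]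

theorem map_ins (φ : A →ₗ[k] B) (X : List h) (f : List h → A) :
    φ (ins k q Q X f) = ins k q Q X (fun a => φ (f a)) := by
  induction X generalizing f with
  | nil => simp [ins]
  | cons x X ih => simp only [ins, map_add, ih, map_unsh]

variable {q Q}

theorem ins_map {p : h →ₗ[k] h} (hp : ∀ x, p (q x) = q (p x))
    (hQ : ∀ X, Q (X.map p) = p (Q X)) (X : List h) (f : List h → A) :
    ins k q Q (X.map p) f = ins k q Q X (fun a => f (a.map p)) := by
  induction X generalizing f with
  | nil => rfl
  | cons x X ih =>
    simp only [List.map_cons, ins, ih, unsh_map, hp]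
    congr 1
    refine unsh_congr _ fun a b _ => ?_
    rw [← List.map_cons, hQ]
    simp [Function.comp_def, hp]

theorem MultiLin.ins {f : List h → A} (hf : MultiLin k f) (hQ : MultiLin k Q) :
    MultiLin k (fun a => HomLie.ins k q Q a f) := by
  intro X Z
  induction X generalizing f with
  | nil =>
    simp only [List.nil_append, HomLie.ins]
    constructor
    · intro x y
      simp only [map_add, fun a => (hf.head a).map_add, (hQ.head _).map_add, ins_add, unsh_add]
      abel
    · intro c x
      simp only [map_smul, fun a => (hf.head a).map_smul, (hQ.head _).map_smul, ins_smul, unsh_smul,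
        smul_add]
  | cons y X ih =>
    have i₁ := ih (hf.cons (q y))
    have i₂ := MultiLin.unsh (k := k) (G := fun a b => f (Q (y :: b) :: a.map q))
      (fun b => (hf.cons _).map q) (fun a => (hQ.cons y).comp ((hf.head (a.map q)).mk' _)) X Z
    simp only [List.cons_append, HomLie.ins]
    exact (i₁.mk' _ + i₂.mk' _).isLinear

/-- `Q` vanishes on the words of length other than `d + 1`. -/
def Supported (Q : List h → A) (d : ℕ) : Prop :=
  ∀ X, X.length ≠ d + 1 → Q X = 0

/-- Inserting `Q` shortens a word by exactly `d`: for any other number of letters `Q` gives 0, and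
`f` kills a zero letter. -/
theorem ins_neg_one_pow {d : ℕ} (hQ : Supported Q d) (X : List h) {f : List h → A}
    (hf : MultiLin k f) :
    ins k q Q X (fun a => (-1 : k) ^ a.length • f a) = (-1 : k) ^ (X.length + d) • ins k q Q X f := by
  induction X generalizing f with
  | nil => simp [ins]
  | cons x X ih =>
    simp only [ins, List.length_cons, smul_add]
    congr 1
    · simp only [pow_succ, mul_smul]
      rw [ih ((hf.cons _).smul (-1)), ins_smul, smul_smul]
      congr 1
      ring
    · rw [← unsh_smul]
      refine unsh_congr _ fun a b hab => ?_
      rw [List.length_map, ← hab]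
      by_cases hb : b.length = d
      · rw [hb]
        congr 1
        refine neg_one_pow_congr ?_
        simp only [Nat.even_add]
        tauto
      · rw [hQ (x :: b) (by simpa using hb), hf.head_zero, smul_zero, smul_zero]

/-- Insertion is a twisted coderivation of degree `d` for unshuffling. The inserted letter falls
into one of the two subwords and all of the other subword is twisted; the sign is that of moving the
operator past `b`. -/
theorem ins_unsh {p : h →ₗ[k] h} {P : List h → h} {d : ℕ} (hP : Supported P d) (X : List h)
    {G : List h → List h → A} (h₁ : ∀ b, MultiLin k (fun a => G a b))
    (h₂ : ∀ a, MultiLin k (fun b => G a b)) :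
    ins k p P X (fun a => unsh k a G)
      = unsh k X (fun a b => (-1 : k) ^ (d * b.length) • ins k p P a (fun c => G c (b.map p)))
        + unsh k X (fun a b => ins k p P b (fun c => G (a.map p) c)) := by
  induction X generalizing G with
  | nil => simp [ins, unsh]
  | cons x X ih =>
    simp only [ins, unsh, unsh_map, List.length_map, List.map_cons, ins_add, unsh_add, smul_add,
      List.length_cons]
    rw [ih (fun b => (h₁ b).cons (p x)) (fun a => h₂ (p x :: a)),
      ih (G := fun a b => (-1 : k) ^ a.length • G a (p x :: b))
        (fun b => (h₁ _).length_smul fun n => (-1) ^ n) (fun a => ((h₂ a).cons (p x)).smul _)]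
    have e₁ : unsh k X (fun a b => (-1 : k) ^ (d * b.length) •
          ins k p P a fun c => (-1 : k) ^ c.length • G c (p x :: b.map p))
        = unsh k X (fun a b => (-1 : k) ^ a.length • (-1 : k) ^ (d * (b.length + 1)) •
          ins k p P a fun c => G c (p x :: b.map p)) := by
      refine unsh_congr _ fun a b _ => ?_
      rw [ins_neg_one_pow hP _ (h₁ _), smul_smul, smul_smul, ← pow_add, ← pow_add]
      congr 1
      refine neg_one_pow_congr ?_
      simp only [Nat.even_add, Nat.even_mul, Nat.even_add_one]
      tauto
    -- Both sides split `X` into three subwords; exchanging the arguments of `P` with the second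
    -- factor costs the sign, because only `d` further arguments contribute.
    have e₂ : unsh k X (fun a b => unsh k a fun c e => G (P (x :: b) :: c.map p) (e.map p))
        = unsh k X (fun a b => (-1 : k) ^ (d * b.length) •
          unsh k a fun c e => G (P (x :: e) :: c.map p) (b.map p)) := by
      simp only [← unsh_smul]
      rw [unsh_coassoc, unsh_coassoc X fun c e b =>
        (-1 : k) ^ (d * b.length) • G (P (x :: e) :: c.map p) (b.map p)]
      refine unsh_congr _ fun a b _ => ?_
      rw [unsh_comm]
      refine unsh_congr _ fun c e _ => ?_
      rw [mul_comm d]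
      by_cases hc : c.length = d
      · rw [hc, mul_comm d]
      · rw [hP (x :: c) (by simpa using hc), (h₁ _).head_zero, smul_zero, smul_zero]
    have e₃ : unsh k X (fun a b => unsh k a fun c e =>
          (-1 : k) ^ c.length • G (c.map p) (P (x :: b) :: e.map p))
        = unsh k X (fun a b => (-1 : k) ^ a.length •
          unsh k b fun c e => G (a.map p) (P (x :: e) :: c.map p)) := by
      simp only [← unsh_smul]
      exact unsh_coassoc X fun c e b => (-1 : k) ^ c.length • G (c.map p) (P (x :: b) :: e.map p)
    rw [e₁, e₂, e₃]
    simp only [ins_smul, List.length_map]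
    abel

/-- Insertions at disjoint places cancel in the commutator; those of one map inside an argument of
the other remain. The hypotheses on `p` and `q` say that a twist may be applied before or after the
other insertion. -/
theorem ins_ins {p q : h →ₗ[k] h} {P Q : List h → h} {d e : ℕ} {f : List h → A}
    (hf : MultiLin k f) (hPl : MultiLin k P) (hQl : MultiLin k Q)
    (hP : Supported P d) (hQ : Supported Q e) (hpq : ∀ x, p (q x) = q (p x))
    (hpQ : ∀ X, Q (X.map p) = p (Q X)) (hqP : ∀ X, P (X.map q) = q (P X)) (X : List h) :
    ins k p P X (fun (a : List h) => ins k q Q a f) - (-1 : k) ^ (d * e) • ins k q Q X (fun (a : List h) => ins k p P a f)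
      = ins k (q ∘ₗ p) (fun Y => ins k p P Y Q - (-1 : k) ^ (d * e) • ins k q Q Y P) X f := by
  induction X generalizing f with
  | nil => simp [ins]
  | cons x X ih =>
    -- The four terms: the last letter `x` is only twisted; it is the last argument of `Q`, or of
    -- `P`, with the other map inserted elsewhere; or it ends the outer word of a nested insertion.
    -- Exchanging `P` and `Q` swaps the two middle terms up to `(-1) ^ (d * e)`, so general data
    -- allow a second use with the roles reversed.
    have key : ∀ {p q : h →ₗ[k] h} {P Q : List h → h} {d e : ℕ}, MultiLin k P → MultiLin k Q →
        Supported P d → Supported Q e → (∀ x, p (q x) = q (p x)) →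
        (∀ X, Q (X.map p) = p (Q X)) → (∀ X, P (X.map q) = q (P X)) →
        ins k p P (x :: X) (fun (a : List h) => ins k q Q a f)
          = ins k p P X (fun (a : List h) => ins k q Q a (fun c => f (q (p x) :: c)))
            + (-1 : k) ^ (d * e) • unsh k X (fun (a b : List h) => ins k p P a fun c =>
              f (Q (p x :: b.map p) :: c.map q))
            + unsh k X (fun (a b : List h) => ins k q Q a fun c => f (P (q x :: b.map q) :: c.map p))
            + unsh k X (fun (a b : List h) => f (ins k p P (x :: b) Q :: a.map (q ∘ₗ p))) := by
      intro p q P Q d e hPl hQl hP hQ hpq hpQ hqP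
      have hb : ∀ a b : List h, f (ins k p P (x :: b) Q :: a.map (q ∘ₗ p))
          = ins k p P b (fun c => f (Q (p x :: c) :: a.map (q ∘ₗ p)))
            + unsh k b (fun (c e : List h) => f (Q (P (x :: e) :: c.map p) :: a.map (q ∘ₗ p))) := by
        intro a b
        have := map_ins (k := k) p P ((hf.head (a.map (q ∘ₗ p))).mk' _) (x :: b) Q
        simp only [IsLinearMap.mk'_apply] at this
        rw [this, ins]
      rw [unsh_congr (k := k) X fun a b _ => hb a b]
      simp only [unsh_add, ins, ins_add]
      rw [ins_unsh hP X (G := fun (a b : List h) => f (Q (p x :: b) :: a.map q))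
        (fun (b : List h) => (hf.cons _).map q)
        (fun a : List h => (hQl.cons _).comp ((hf.head (a.map q)).mk' _))]
      have e₁ : unsh k X (fun (a b : List h) => (-1 : k) ^ (d * b.length) • ins k p P a fun c =>
            f (Q (p x :: b.map p) :: c.map q))
          = (-1 : k) ^ (d * e) • unsh k X (fun (a b : List h) => ins k p P a fun c =>
            f (Q (p x :: b.map p) :: c.map q)) := by
        rw [← unsh_smul]
        refine unsh_congr _ fun a b _ => ?_
        by_cases hb : b.length = e
        · rw [hb]
        · rw [hQ (p x :: b.map p) (by simpa using hb)]
          simp only [hf.head_zero, ins_zero, smul_zero]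
      have e₂ : unsh k X (fun (a b : List h) => ins k q Q (a.map p) fun c => f (q (P (x :: b)) :: c))
          = unsh k X (fun (a b : List h) => ins k q Q a fun c => f (P (q x :: b.map q) :: c.map p)) := by
        refine unsh_congr _ fun a b _ => ?_
        rw [ins_map hpq hpQ, ← hqP, List.map_cons]
      have e₃ : unsh k X (fun (a b : List h) => unsh k (a.map p) fun (c e : List h) =>
            f (Q (P (x :: b) :: e) :: c.map q))
          = unsh k X (fun (a b : List h) => unsh k b fun (c e : List h) =>
            f (Q (P (x :: e) :: c.map p) :: a.map (q ∘ₗ p))) := by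
        simp only [unsh_map, List.map_map]
        rw [unsh_coassoc X fun c e b => f (Q (P (x :: b) :: e.map p) :: c.map (q ∘ p))]
        rfl
      rw [e₁, e₂, e₃]
      simp only [List.map_map, LinearMap.coe_comp]
      abel
    have hX : ∀ a b : List h, f ((ins k p P (x :: b) Q - (-1 : k) ^ (d * e) • ins k q Q (x :: b) P)
          :: a.map (q ∘ₗ p)) = f (ins k p P (x :: b) Q :: a.map (q ∘ₗ p))
            - (-1 : k) ^ (d * e) • f (ins k q Q (x :: b) P :: a.map (q ∘ₗ p)) := by
      intro a b
      have := (hf.head (a.map (q ∘ₗ p)))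
      rw [this.map_sub, this.map_smul]
    have e₄ : unsh k X (fun (a b : List h) => f ((ins k p P (x :: b) Q - (-1 : k) ^ (d * e) •
          ins k q Q (x :: b) P) :: a.map (q ∘ₗ p)))
        = unsh k X (fun (a b : List h) => f (ins k p P (x :: b) Q :: a.map (q ∘ₗ p))) - (-1 : k) ^ (d * e) •
          unsh k X (fun (a b : List h) => f (ins k q Q (x :: b) P :: a.map (q ∘ₗ p))) :=
      (unsh_congr _ fun a b _ => hX a b).trans
        (by simp only [sub_eq_add_neg, ← neg_smul, unsh_add, unsh_smul])
    have hc : p ∘ₗ q = q ∘ₗ p := LinearMap.ext hpq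
    have s : (-1 : k) ^ (d * e) * (-1 : k) ^ (d * e) = 1 := by
      rw [← mul_pow]; simp
    rw [key hPl hQl hP hQ hpq hpQ hqP, key hQl hPl hQ hP (fun x => (hpq x).symm) hqP hpQ,
      ins, e₄, LinearMap.comp_apply, ← ih (hf.cons _), hc]
    simp only [smul_add, smul_smul, mul_comm e d, hpq, s, one_smul]
    abel

end Words

/-! ### Recursion for shuffles on the position of the largest letter. -/

section Shuffles

/-- The permutation of `N + 1` letters that sends `p` to the last letter and acts on the remaining
letters as `τ`. -/
def insertLast {N : ℕ} (p : Fin (N + 1)) (τ : Equiv.Perm (Fin N)) : Equiv.Perm (Fin (N + 1)) :=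
  finSuccEquivLast.symm.permCongr (Equiv.optionCongr τ) * (Fin.cycleIcc p (Fin.last N))⁻¹

variable {N : ℕ}

theorem insertLast_self (p : Fin (N + 1)) (τ : Equiv.Perm (Fin N)) :
    insertLast p τ p = Fin.last N := by
  have h : (Fin.cycleIcc p (Fin.last N))⁻¹ p = Fin.last N := by
    rw [Equiv.Perm.inv_eq_iff_eq, Fin.cycleIcc_of_last (Fin.le_last p)]
  rw [insertLast, Equiv.Perm.mul_apply, h]
  simp [Equiv.permCongr_apply]

theorem insertLast_succAbove (p : Fin (N + 1)) (τ : Equiv.Perm (Fin N)) (j : Fin N) :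
    insertLast p τ (p.succAbove j) = (τ j).castSucc := by
  have h : (Fin.cycleIcc p (Fin.last N))⁻¹ (p.succAbove j) = j.castSucc := by
    rw [Equiv.Perm.inv_eq_iff_eq]
    have := congrFun (Fin.cycleIcc_comp_succAbove p (Fin.last N) (Fin.le_last p)) j
    simpa using this.symm
  rw [insertLast, Equiv.Perm.mul_apply, h]
  simp [Equiv.permCongr_apply]

theorem sign_insertLast (p : Fin (N + 1)) (τ : Equiv.Perm (Fin N)) :
    Equiv.Perm.sign (insertLast p τ) = (-1) ^ (N - (p : ℕ)) * Equiv.Perm.sign τ := by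
  rw [insertLast, map_mul, map_inv, Equiv.Perm.sign_permCongr, Equiv.optionCongr_sign,
    Fin.sign_cycleIcc_of_le (Fin.le_last p), mul_comm, Int.units_inv_eq_self, Fin.val_last]

theorem insertLast_bijective :
    Function.Bijective fun z : Fin (N + 1) × Equiv.Perm (Fin N) => insertLast z.1 z.2 := by
  rw [Fintype.bijective_iff_injective_and_card]
  refine ⟨?_, by simp [Fintype.card_perm, Nat.factorial_succ]⟩
  rintro ⟨p, τ⟩ ⟨p', τ'⟩ h
  simp only at h
  have hp : p = p' := by
    apply (insertLast p' τ').injective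
    rw [insertLast_self, ← h, insertLast_self]
  subst hp
  refine Prod.ext rfl (Equiv.ext fun j => ?_)
  have := congrArg (fun σ => σ (p.succAbove j)) h
  simpa only [insertLast_succAbove, Fin.castSucc_inj] using this

theorem mem_shuffles {a b : ℕ} {σ : Equiv.Perm (Fin N)} :
    σ ∈ shuffles N a b ↔ (∀ j l : Fin N, j < l → (l : ℕ) < a → σ j < σ l) ∧
      (∀ j l : Fin N, a ≤ (j : ℕ) → j < l → (l : ℕ) < a + b → σ j < σ l) ∧
      (∀ j : Fin N, a + b ≤ (j : ℕ) → σ j = j) := by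
  simp [shuffles]

theorem val_succAbove (p : Fin (N + 1)) (j : Fin N) :
    (p.succAbove j : ℕ) = if (j : ℕ) < p then (j : ℕ) else j + 1 := by
  simp only [Fin.succAbove, Fin.lt_def, Fin.val_castSucc]
  split_ifs <;> simp

/-- With `a + b ≤ N` the last letter lies beyond both blocks, so a shuffle must fix it. -/
theorem insertLast_last_mem_shuffles {a b : ℕ} (hN : a + b ≤ N) (p : Fin (N + 1))
    (τ : Equiv.Perm (Fin N)) :
    insertLast p τ ∈ shuffles (N + 1) a b ↔ p = Fin.last N ∧ τ ∈ shuffles N a b := by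
  simp only [mem_shuffles]
  constructor
  · rintro ⟨h₁, h₂, h₃⟩
    have hp : p = Fin.last N := by
      apply (insertLast p τ).injective
      rw [insertLast_self, h₃ _ (by simpa using hN)]
    subst hp
    have e : ∀ j : Fin N, insertLast (Fin.last N) τ j.castSucc = (τ j).castSucc := fun j => by
      rw [← insertLast_succAbove, Fin.succAbove_last]
    refine ⟨rfl, fun j l hjl hl => ?_, fun j l hj hjl hl => ?_, fun j hj => ?_⟩
    · simpa [e] using h₁ j.castSucc l.castSucc (by simpa using hjl) (by simpa using hl)
    · simpa [e] using h₂ j.castSucc l.castSucc (by simpa using hj) (by simpa using hjl)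
        (by simpa using hl)
    · simpa [e] using h₃ j.castSucc (by simpa using hj)
  · rintro ⟨rfl, h₁, h₂, h₃⟩
    have e : ∀ j : Fin N, insertLast (Fin.last N) τ j.castSucc = (τ j).castSucc := fun j => by
      rw [← insertLast_succAbove, Fin.succAbove_last]
    refine ⟨fun j l hjl hl => ?_, fun j l hj hjl hl => ?_, fun j hj => ?_⟩
    · obtain ⟨j, rfl⟩ := Fin.exists_castSucc_eq.mpr (show j ≠ Fin.last N by
        rintro rfl; simp [Fin.lt_def] at hjl; omega)
      obtain ⟨l, rfl⟩ := Fin.exists_castSucc_eq.mpr (show l ≠ Fin.last N by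
        rintro rfl; simp at hl; omega)
      simpa [e] using h₁ j l (by simpa using hjl) (by simpa using hl)
    · obtain ⟨j, rfl⟩ := Fin.exists_castSucc_eq.mpr (show j ≠ Fin.last N by
        rintro rfl; simp [Fin.lt_def] at hjl; omega)
      obtain ⟨l, rfl⟩ := Fin.exists_castSucc_eq.mpr (show l ≠ Fin.last N by
        rintro rfl; simp at hl; omega)
      simpa [e] using h₂ j l (by simpa using hj) (by simpa using hjl) (by simpa using hl)
    · rcases Fin.eq_castSucc_or_eq_last j with ⟨j, rfl⟩ | rfl
      · simpa [e] using h₃ j (by simpa using hj)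
      · exact insertLast_self _ _

/-- The largest value of a shuffle without fixed tail stands at the end of one of the two increasing
blocks. These two cases mirror the two terms in the recursion of `unsh`. -/
theorem insertLast_mem_shuffles {a b : ℕ} (hN : a + b = N + 1) (p : Fin (N + 1))
    (τ : Equiv.Perm (Fin N)) :
    insertLast p τ ∈ shuffles (N + 1) a b ↔
      ((p : ℕ) + 1 = a ∧ τ ∈ shuffles N (a - 1) b) ∨
        (p = Fin.last N ∧ 0 < b ∧ τ ∈ shuffles N a (b - 1)) := by
  have lt_iff : ∀ j l : Fin N, insertLast p τ (p.succAbove j) < insertLast p τ (p.succAbove l) ↔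
      τ j < τ l := fun j l => by
    rw [insertLast_succAbove, insertLast_succAbove, Fin.castSucc_lt_castSucc_iff]
  have no_lt : ∀ l : Fin (N + 1), ¬ insertLast p τ p < insertLast p τ l := fun l => by
    rw [insertLast_self]; exact not_lt.mpr (Fin.le_last _)
  have lt_self : ∀ j : Fin N, insertLast p τ (p.succAbove j) < insertLast p τ p := fun j => by
    rw [insertLast_succAbove, insertLast_self]; exact Fin.castSucc_lt_last _
  have hpN := p.2
  simp only [mem_shuffles]
  constructor
  · rintro ⟨h₁, h₂, -⟩
    rcases lt_or_ge (p : ℕ) a with hp | hp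
    · have hpa : (p : ℕ) + 1 = a := by
        by_contra hne
        exact no_lt _ (h₁ p ⟨p + 1, by omega⟩ (by simp [Fin.lt_def]) (by simp only; omega))
      refine Or.inl ⟨hpa, fun j l hjl hl => ?_, fun j l hj hjl hl => ?_, fun j hj => ?_⟩
      · rw [← lt_iff]
        refine h₁ _ _ ?_ ?_
        · rw [Fin.lt_def] at hjl ⊢
          simp only [val_succAbove]
          split_ifs <;> omega
        · simp only [val_succAbove]
          split_ifs <;> omega
      · rw [← lt_iff]
        refine h₂ _ _ ?_ ?_ ?_
        · simp only [val_succAbove]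
          split_ifs <;> omega
        · rw [Fin.lt_def] at hjl ⊢
          simp only [val_succAbove]
          split_ifs <;> omega
        · simp only [val_succAbove]
          split_ifs <;> omega
      · omega
    · have hpa : (p : ℕ) = N := by
        by_contra hne
        exact no_lt _ (h₂ p ⟨p + 1, by omega⟩ hp (by simp [Fin.lt_def]) (by simp only; omega))
      refine Or.inr ⟨Fin.ext hpa, by omega, fun j l hjl hl => ?_, fun j l hj hjl hl => ?_,
        fun j hj => ?_⟩
      · rw [← lt_iff]
        refine h₁ _ _ ?_ ?_
        · rw [Fin.lt_def] at hjl ⊢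
          simp only [val_succAbove]
          split_ifs <;> omega
        · simp only [val_succAbove]
          split_ifs <;> omega
      · rw [← lt_iff]
        refine h₂ _ _ ?_ ?_ ?_
        · simp only [val_succAbove]
          split_ifs <;> omega
        · rw [Fin.lt_def] at hjl ⊢
          simp only [val_succAbove]
          split_ifs <;> omega
        · simp only [val_succAbove]
          split_ifs <;> omega
      · omega
  · intro H
    have fixes : ∀ j : Fin (N + 1), a + b ≤ (j : ℕ) → insertLast p τ j = j := fun j hj => by omega
    rcases H with ⟨hpa, h₁, h₂, -⟩ | ⟨hp, hb, h₁, h₂, -⟩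
    · refine ⟨fun j l hjl hl => ?_, fun j l hj hjl hl => ?_, fixes⟩
      · rcases Fin.eq_self_or_eq_succAbove p j with rfl | ⟨j, rfl⟩
        · rw [Fin.lt_def] at hjl; omega
        rcases Fin.eq_self_or_eq_succAbove p l with rfl | ⟨l, rfl⟩
        · exact lt_self j
        rw [lt_iff]
        rw [Fin.lt_def] at hjl
        simp only [val_succAbove] at hjl hl
        refine h₁ j l ?_ ?_
        · rw [Fin.lt_def]; split_ifs at hjl hl <;> omega
        · split_ifs at hjl hl <;> omega
      · rcases Fin.eq_self_or_eq_succAbove p j with rfl | ⟨j, rfl⟩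
        · omega
        rcases Fin.eq_self_or_eq_succAbove p l with rfl | ⟨l, rfl⟩
        · exact lt_self j
        rw [lt_iff]
        rw [Fin.lt_def] at hjl
        simp only [val_succAbove] at hj hjl hl
        refine h₂ j l ?_ ?_ ?_
        · split_ifs at hj hjl hl <;> omega
        · rw [Fin.lt_def]; split_ifs at hjl hl <;> omega
        · split_ifs at hjl hl <;> omega
    · have hpv : (p : ℕ) = N := by rw [hp]; rfl
      refine ⟨fun j l hjl hl => ?_, fun j l hj hjl hl => ?_, fixes⟩
      · rcases Fin.eq_self_or_eq_succAbove p j with rfl | ⟨j, rfl⟩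
        · rw [Fin.lt_def] at hjl; omega
        rcases Fin.eq_self_or_eq_succAbove p l with rfl | ⟨l, rfl⟩
        · exact lt_self j
        rw [lt_iff]
        rw [Fin.lt_def] at hjl
        simp only [val_succAbove] at hjl hl
        refine h₁ j l ?_ ?_
        · rw [Fin.lt_def]; split_ifs at hjl hl <;> omega
        · split_ifs at hjl hl <;> omega
      · rcases Fin.eq_self_or_eq_succAbove p j with rfl | ⟨j, rfl⟩
        · rw [Fin.lt_def] at hjl; omega
        rcases Fin.eq_self_or_eq_succAbove p l with rfl | ⟨l, rfl⟩
        · exact lt_self j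
        rw [lt_iff]
        rw [Fin.lt_def] at hjl
        simp only [val_succAbove] at hj hjl hl
        refine h₂ j l ?_ ?_ ?_
        · split_ifs at hj hjl hl <;> omega
        · rw [Fin.lt_def]; split_ifs at hjl hl <;> omega
        · split_ifs at hjl hl <;> omega

variable {A : Type*} [AddCommGroup A]

theorem sum_perm_succ (s : Finset (Equiv.Perm (Fin (N + 1)))) (f : Equiv.Perm (Fin (N + 1)) → A) :
    ∑ σ ∈ s, f σ = ∑ p : Fin (N + 1), ∑ τ : Equiv.Perm (Fin N),
      if insertLast p τ ∈ s then f (insertLast p τ) else 0 := by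
  rw [← Fintype.sum_prod_type', insertLast_bijective.sum_comp fun σ => if σ ∈ s then f σ else 0,
    ← Finset.sum_filter, Finset.filter_univ_mem]

theorem sum_shuffles_of_le {a b : ℕ} (hN : a + b ≤ N) (f : Equiv.Perm (Fin (N + 1)) → A) :
    ∑ σ ∈ shuffles (N + 1) a b, f σ = ∑ τ ∈ shuffles N a b, f (insertLast (Fin.last N) τ) := by
  rw [sum_perm_succ, Finset.sum_eq_single (Fin.last N)]
  · simp only [insertLast_last_mem_shuffles hN, true_and]
    rw [← Finset.sum_filter]
    simp
  · intro p _ hp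
    simp [insertLast_last_mem_shuffles hN, hp]
  · simp

theorem sum_shuffles_of_eq {a b : ℕ} (hN : a + b = N + 1) (f : Equiv.Perm (Fin (N + 1)) → A) :
    ∑ σ ∈ shuffles (N + 1) a b, f σ
      = (if h : 0 < a then ∑ τ ∈ shuffles N (a - 1) b, f (insertLast ⟨a - 1, by omega⟩ τ) else 0)
        + (if 0 < b then ∑ τ ∈ shuffles N a (b - 1), f (insertLast (Fin.last N) τ) else 0) := by
  have split : ∀ (p : Fin (N + 1)) (τ : Equiv.Perm (Fin N)),
      (if insertLast p τ ∈ shuffles (N + 1) a b then f (insertLast p τ) else 0)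
        = (if (p : ℕ) + 1 = a ∧ τ ∈ shuffles N (a - 1) b then f (insertLast p τ) else 0)
          + (if p = Fin.last N ∧ 0 < b ∧ τ ∈ shuffles N a (b - 1) then f (insertLast p τ) else 0) := by
    intro p τ
    simp only [insertLast_mem_shuffles hN]
    by_cases h₁ : (p : ℕ) + 1 = a ∧ τ ∈ shuffles N (a - 1) b
    · have h₂ : ¬ (p = Fin.last N ∧ 0 < b ∧ τ ∈ shuffles N a (b - 1)) := by
        rintro ⟨rfl, hb, -⟩
        have := h₁.1
        simp at this
        omega
      rw [if_pos (Or.inl h₁), if_pos h₁, if_neg h₂, add_zero]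
    · simp only [h₁, false_or, if_false, zero_add]
  simp only [sum_perm_succ, split, Finset.sum_add_distrib]
  congr 1
  · split_ifs with ha
    · rw [Finset.sum_eq_single ⟨a - 1, by omega⟩]
      · have : a - 1 + 1 = a := by omega
        simp only [this, true_and]
        rw [← Finset.sum_filter]
        simp
      · intro p _ hp
        have : (p : ℕ) + 1 ≠ a := fun h => hp (Fin.ext (by simp only; omega))
        simp [this]
      · simp
    · refine Finset.sum_eq_zero fun p _ => Finset.sum_eq_zero fun τ _ => if_neg ?_
      omega
  · rw [Finset.sum_eq_single (Fin.last N)]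
    · split_ifs with hb
      · simp only [true_and, hb]
        rw [← Finset.sum_filter]
        simp
      · simp [hb]
    · intro p _ hp
      simp [hp]
    · simp

end Shuffles

/-! ### From sums over permutations to words. -/

section Bridge

variable {k h A : Type*} [Field k] [AddCommGroup h] [Module k h] [AddCommGroup A] [Module k A]

/-- The word, read backwards, of a family of letters. -/
def word {N : ℕ} (x : Fin N → h) : List h :=
  (List.ofFn x).reverse

@[simp] theorem length_word {N : ℕ} (x : Fin N → h) : (word x).length = N := by
  simp [word]

theorem word_getElem {N : ℕ} (x : Fin N → h) (i : ℕ) (hi : i < (word x).length) :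
    (word x)[i] = x ⟨N - 1 - i, by rw [length_word] at hi; omega⟩ := by
  simp [word]

theorem word_succ {N : ℕ} (x : Fin (N + 1) → h) :
    word x = x (Fin.last N) :: word (fun i => x i.castSucc) := by
  rw [word, List.ofFn_succ', List.concat_eq_append, List.reverse_append]
  rfl

theorem exists_word {N : ℕ} {X : List h} (hX : X.length = N) : ∃ x : Fin N → h, word x = X := by
  subst hX
  refine ⟨fun i => X[X.length - 1 - i], List.ext_getElem (by simp) fun i h₁ h₂ => ?_⟩
  rw [word_getElem]
  congr 1
  simp only
  omega

theorem map_word {N : ℕ} {B : Type*} (p : h → B) (x : Fin N → h) :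
    (word x).map p = word fun i => p (x i) := by
  simp [word, List.map_reverse, List.map_ofFn, Function.comp_def]

theorem word_insertLast {N : ℕ} (x : Fin (N + 1) → h) (p : Fin (N + 1))
    (τ : Equiv.Perm (Fin N)) :
    word (fun i => x (insertLast p τ i))
      = (word fun i => x (τ i).castSucc).take (N - p)
        ++ x (Fin.last N) :: (word fun i => x (τ i).castSucc).drop (N - p) := by
  have hp := p.2
  refine List.ext_getElem (by simp; omega) fun i h₁ h₂ => ?_
  rw [length_word] at h₁
  rw [word_getElem, List.getElem_append]
  simp only [List.length_take, length_word]
  split_ifs with hi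
  · rw [List.getElem_take, word_getElem]
    have : (⟨N + 1 - 1 - i, by omega⟩ : Fin (N + 1)) = p.succAbove ⟨N - 1 - i, by omega⟩ := by
      apply Fin.ext
      simp only [val_succAbove]
      split_ifs <;> omega
    rw [this, insertLast_succAbove]
  · rcases Nat.lt_or_ge (N - p) i with hi' | hi'
    · rw [List.getElem_cons, dif_neg (by omega), List.getElem_drop, word_getElem]
      have : (⟨N + 1 - 1 - i, by omega⟩ : Fin (N + 1)) = p.succAbove ⟨N - i, by omega⟩ := by
        apply Fin.ext
        simp only [val_succAbove]
        split_ifs <;> omega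
      rw [this, insertLast_succAbove]
      congr 4
      omega
    · rw [List.getElem_cons, dif_pos (by omega)]
      have : (⟨N + 1 - 1 - i, by omega⟩ : Fin (N + 1)) = p := by
        apply Fin.ext
        simp only
        omega
      rw [this, insertLast_self]

theorem units_smul (u : ℤˣ) (v : A) : u • v = ((u : ℤ) : k) • v := by
  rw [Units.smul_def, Int.cast_smul_eq_zsmul]

/-- Read backwards, a shuffled family is `Y ++ X`, while `unsh` carries the sign of `X ++ Y`; the
factor `(-1) ^ (a * b)` makes up the difference. -/
theorem sum_shuffles_eq_unsh {N a b : ℕ} (hN : a + b = N) (x : Fin N → h) (F : List h → A) :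
    ∑ σ ∈ shuffles N a b, ((-1 : ℤˣ) ^ (a * b) * Equiv.Perm.sign σ) • F (word fun i => x (σ i))
      = unsh k (word x) (fun X Y => if X.length = a then F (Y ++ X) else 0) := by
  induction N generalizing a b F with
  | zero =>
    obtain ⟨rfl, rfl⟩ : a = 0 ∧ b = 0 := by omega
    have e : shuffles 0 0 0 = {1} := by
      ext σ
      simp [mem_shuffles, Subsingleton.elim σ 1]
    simp [e, word, unsh]
  | succ N ih =>
    rw [sum_shuffles_of_eq hN, word_succ, unsh]
    congr 1
    · split_ifs with ha
      · have e := ih (a := a - 1) (b := b) (by omega) (fun i => x i.castSucc)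
          -- The largest letter ends the first block, hence stands just behind the `b` letters of
          -- the second block in the backward reading.
          (fun W => F (W.take b ++ x (Fin.last N) :: W.drop b))
        refine Eq.trans (Finset.sum_congr rfl fun τ _ => ?_) (e.trans ?_)
        · have e : N - (a - 1) = b := by omega
          rw [word_insertLast, sign_insertLast]
          simp only [e]
          congr 1
          rw [← mul_assoc, ← pow_add]
          congr 1
          obtain ⟨a, rfl⟩ : ∃ c, a = c + 1 := ⟨a - 1, by omega⟩
          rw [add_mul, one_mul, Nat.add_sub_cancel, add_assoc, pow_add, ← two_mul, pow_mul]
          simp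
        · refine unsh_congr _ fun X Y hXY => ?_
          rw [length_word] at hXY
          by_cases hX : X.length = a - 1
          · have : Y.length = b := by omega
            rw [if_pos hX, if_pos (by simp only [List.length_cons]; omega), ← this,
              List.take_left, List.drop_left]
          · rw [if_neg hX, if_neg (by simp only [List.length_cons]; omega)]
      · refine Eq.symm ((unsh_congr _ fun X Y hXY => ?_).trans (unsh_zero (k := k) _))
        rw [if_neg (by simp only [List.length_cons]; omega)]
    · split_ifs with hb
      · have e := ih (a := a) (b := b - 1) (by omega) (fun i => x i.castSucc)
          (fun W => F (x (Fin.last N) :: W))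
        refine Eq.trans ?_ ((congrArg (fun v => (-1 : k) ^ a • v) e).trans ?_)
        · simp only [Finset.smul_sum]
          refine Finset.sum_congr rfl fun τ _ => ?_
          rw [word_insertLast, sign_insertLast]
          simp only [Fin.val_last, Nat.sub_self, List.take_zero, List.drop_zero, List.nil_append,
            pow_zero, one_mul]
          rw [units_smul (k := k), units_smul (k := k), smul_smul]
          congr 1
          obtain ⟨b, rfl⟩ : ∃ c, b = c + 1 := ⟨b - 1, by omega⟩
          push_cast
          ring
        · rw [← unsh_smul]
          refine unsh_congr _ fun X Y hXY => ?_
          by_cases hX : X.length = a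
          · rw [if_pos hX, if_pos hX, hX]
            rfl
          · rw [if_neg hX, if_neg hX, smul_zero, smul_zero]
      · refine Eq.symm ((unsh_congr _ fun X Y hXY => ?_).trans (unsh_zero (k := k) _))
        rw [length_word] at hXY
        rw [if_neg (by omega), smul_zero]

/-- The `c` fixed final letters are the first `c` letters of the backward word, so they can be
stripped off one at a time. -/
theorem sum_shuffles_eq_unsh_drop {N a b c : ℕ} (hN : a + b + c = N) (x : Fin N → h)
    (F : List h → A) :
    ∑ σ ∈ shuffles N a b, ((-1 : ℤˣ) ^ (a * b) * Equiv.Perm.sign σ) • F (word fun i => x (σ i))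
      = unsh k ((word x).drop c)
        (fun X Y => if X.length = a then F ((word x).take c ++ (Y ++ X)) else 0) := by
  induction c generalizing N F with
  | zero => simpa using sum_shuffles_eq_unsh (k := k) (a := a) (b := b) hN x F
  | succ c ih =>
    obtain ⟨N, rfl⟩ : ∃ M, N = M + 1 := ⟨N - 1, by omega⟩
    rw [sum_shuffles_of_le (by omega), word_succ]
    simp only [List.drop_succ_cons, List.take_succ_cons, List.cons_append]
    refine Eq.trans ?_ (ih (by omega) _ fun W => F (x (Fin.last N) :: W))
    refine Finset.sum_congr rfl fun τ _ => ?_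
    rw [word_insertLast, sign_insertLast]
    simp

/-- Unrolls the recursion: `j` counts the letters standing after the last argument of `Q`. -/
theorem ins_eq_sum (q : h →ₗ[k] h) (Q : List h → h) (X : List h) (f : List h → A) :
    ins k q Q X f = ∑ j ∈ Finset.range X.length, unsh k (X.drop (j + 1)) fun a b =>
      f ((X.take j).map q ++ Q (X.getD j 0 :: b) :: a.map q) := by
  induction X generalizing f with
  | nil => simp [ins]
  | cons x X ih =>
    rw [ins, ih, List.length_cons, Finset.sum_range_succ']
    simp

/-- The function of words given by a multilinear map. -/
def ofWord {m : ℕ} (P : MultilinearMap k (fun _ : Fin m => h) A) (X : List h) : A :=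
  if X.length = m then P (fun i => X.getD (m - 1 - i) 0) else 0

theorem ofWord_word {m : ℕ} (P : MultilinearMap k (fun _ : Fin m => h) A) (x : Fin m → h) :
    ofWord P (word x) = P x := by
  rw [ofWord, if_pos (length_word x)]
  congr 1
  funext i
  have hi := i.2
  rw [List.getD_eq_getElem _ _ (by rw [length_word]; omega), word_getElem]
  congr 1
  apply Fin.ext
  simp only
  omega

theorem ofWord_of_length_ne {m : ℕ} (P : MultilinearMap k (fun _ : Fin m => h) A) {X : List h}
    (hX : X.length ≠ m) : ofWord P X = 0 :=
  if_neg hX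

theorem multiLin_ofWord {m : ℕ} (P : MultilinearMap k (fun _ : Fin m => h) A) :
    MultiLin k (ofWord P) := by
  intro X Z
  by_cases hm : X.length + (Z.length + 1) = m
  · have e : ∀ v, ofWord P (X ++ v :: Z) = P (Function.update
        (fun i : Fin m => (X ++ 0 :: Z).getD (m - 1 - i) 0) ⟨m - 1 - X.length, by omega⟩ v) := by
      intro v
      rw [ofWord, if_pos (by simpa using hm)]
      congr 1
      funext i
      have hi := i.2
      simp only [Function.update_apply, Fin.ext_iff]
      split_ifs with h'
      · rw [h', show m - 1 - (m - 1 - X.length) = X.length by omega]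
        simp
      · rcases Nat.lt_or_ge (m - 1 - i) X.length with h'' | h''
        · rw [List.getD_append _ _ _ _ h'', List.getD_append _ _ _ _ h'']
        · rw [List.getD_append_right _ _ _ _ h'', List.getD_append_right _ _ _ _ h'',
            show m - 1 - (i : ℕ) - X.length = (m - 1 - i - X.length - 1) + 1 by omega]
          simp
    simp only [e]
    exact ⟨fun x y => P.map_update_add _ _ _ _, fun c x => P.map_update_smul _ _ _ _⟩
  · have e : ∀ v, ofWord P (X ++ v :: Z) = 0 := fun v =>
      ofWord_of_length_ne P (by simpa using hm)
    simp only [e]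
    exact ⟨fun _ _ => (add_zero _).symm, fun c _ => (smul_zero c).symm⟩

theorem ofWord_map {m : ℕ} {P : MultilinearMap k (fun _ : Fin m => h) h} {p : h →ₗ[k] h}
    (hP : ∀ x, p (P x) = P fun i => p (x i)) (X : List h) :
    ofWord P (X.map p) = p (ofWord P X) := by
  by_cases hX : X.length = m
  · obtain ⟨x, rfl⟩ := exists_word hX
    rw [map_word, ofWord_word, ofWord_word, hP]
  · rw [ofWord_of_length_ne P hX, ofWord_of_length_ne P (by simpa using hX), map_zero]

theorem insertArgs_eq (α : h →ₗ[k] h) {m n N : ℕ} (hN : N + 1 = m + n) (hn : 1 ≤ n)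
    (P Q) (i : Fin m) (x : Fin N → h) :
    (P : MultilinearMap k (fun _ : Fin m => h) h) (insertArgs α hN Q i x)
      = ofWord P (((word x).take (m - 1 - i)).map (α ^ (n - 1))
        ++ ofWord Q (((word x).drop (m - 1 - i)).take n)
          :: ((word x).drop (m - 1 - i + n)).map (α ^ (n - 1))) := by
  have hi := i.2
  rw [← ofWord_word P]
  congr 1
  refine List.ext_getElem (by simp; omega) fun l h₁ h₂ => ?_
  rw [length_word] at h₁
  rw [word_getElem, List.getElem_append]
  simp only [List.length_map, List.length_take, length_word, insertArgs, Fin.lt_def, Fin.ext_iff]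
  split_ifs with c₁ c₂ c₃ c₄ c₅ <;> try omega
  · rw [List.getElem_cons, dif_neg (by omega), List.getElem_map, List.getElem_drop, word_getElem]
    congr 3
    omega
  · rw [List.getElem_cons, dif_pos (by omega), ← ofWord_word Q]
    congr 1
    refine List.ext_getElem (by simp; omega) fun r h₃ h₄ => ?_
    rw [length_word] at h₃
    rw [word_getElem, List.getElem_take, List.getElem_drop, word_getElem]
    congr 2
    simp only
    omega
  · rw [List.getElem_map, List.getElem_take, word_getElem]
    congr 3
    omega

/-- In `P ⋄ Q` the last argument of `Q` is never permuted and only earlier letters are shuffled.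
This is what lets `ins` recurse on the last letter. -/
theorem diamondAux_apply (α : h →ₗ[k] h) {m n N : ℕ} (hN : N + 1 = m + n) (hn : 1 ≤ n)
    (P : MultilinearMap k (fun _ : Fin m => h) h) (Q : MultilinearMap k (fun _ : Fin n => h) h)
    (x : Fin N → h) :
    diamondAux α hN P Q x = ins k (α ^ (n - 1)) (ofWord Q) (word x) (ofWord P) := by
  have hx := length_word x
  -- Slot `i` of `P` has `j = m - 1 - i` slots behind it; for `j ≥ m` the new word is too long for
  -- `P`.
  rw [ins_eq_sum, hx, ← Finset.sum_subset (s₁ := Finset.range m)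
    (by intro j; simp only [Finset.mem_range]; omega), ← Finset.sum_range_reflect,
    ← Fin.sum_univ_eq_sum_range (fun j => unsh k ((word x).drop (m - 1 - j + 1)) fun a b =>
      ofWord P (((word x).take (m - 1 - j)).map (α ^ (n - 1))
        ++ ofWord Q ((word x).getD (m - 1 - j) 0 :: b) :: a.map (α ^ (n - 1))))]
  · rw [diamondAux, sum_apply]
    refine Finset.sum_congr rfl fun i _ => ?_
    have hi := i.2
    have e := sum_shuffles_eq_unsh_drop (k := k) (a := i) (b := n - 1) (c := m - i) (by omega) x
      (fun Y => ofWord P ((Y.take (m - 1 - i)).map (α ^ (n - 1))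
        ++ ofWord Q ((Y.drop (m - 1 - i)).take n) :: (Y.drop (m - 1 - i + n)).map (α ^ (n - 1))))
    rw [sum_apply]
    refine Eq.trans (Finset.sum_congr rfl fun σ _ => ?_) (e.trans ?_)
    · rw [← insertArgs_eq α hN hn]
      rfl
    · rw [show m - 1 - (i : ℕ) + 1 = m - i by omega]
      refine unsh_congr _ fun X Y hXY => ?_
      rw [List.length_drop, hx] at hXY
      split_ifs with hX
      · have hY : Y.length = n - 1 := by omega
        have hl : m - 1 - (i : ℕ) < (word x).length := by omega
        have ht : (word x).take (m - i) = (word x).take (m - 1 - i) ++ [(word x).getD (m - 1 - i) 0] := by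
          rw [List.getD_eq_getElem _ _ hl, List.take_concat_get', show m - 1 - (i : ℕ) + 1 = m - i by omega]
        have hl' : ((word x).take (m - 1 - i)).length = m - 1 - i := by
          rw [List.length_take, min_eq_left hl.le]
        rw [ht, List.append_assoc, List.singleton_append, List.take_left' hl', List.drop_left' hl',
          ← List.drop_drop, List.drop_left' hl', ← List.cons_append, List.take_left' (by simp; omega),
          List.drop_left' (by simp; omega)]
      · rw [ofWord_of_length_ne]
        simp
        omega
  · intro j _ hj
    rw [Finset.mem_range] at hj
    refine (unsh_congr _ fun X Y hXY => ofWord_of_length_ne _ ?_).trans (unsh_zero (k := k) _)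
    rw [List.length_drop, hx] at hXY
    rw [Finset.mem_range] at *
    simp
    omega

end Bridge

/-- The graded commutator, in the opposite order, of operators of degrees `d` and `e`. -/
def gradedComm (k : Type*) {E : Type*} [Field k] [Ring E] [Algebra k E] (d e : ℕ) (a b : E) : E :=
  b * a - (-1 : k) ^ (d * e) • (a * b)

/-! ### Cochains as insertion operators; Balavoine's bracket as a graded commutator. -/

section Operators

variable {k h A : Type*} [Field k] [AddCommGroup h] [Module k h] [AddCommGroup A] [Module k A]

theorem supported_ofWord {m : ℕ} (hm : 1 ≤ m) (P : MultilinearMap k (fun _ : Fin m => h) A) :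
    Supported (ofWord P) (m - 1) := fun X hX =>
  ofWord_of_length_ne P (by omega)

theorem ins_ofWord_of_length_ne {m n : ℕ} (hn : 1 ≤ n)
    (P : MultilinearMap k (fun _ : Fin m => h) A) (Q : MultilinearMap k (fun _ : Fin n => h) h)
    (q : h →ₗ[k] h) {X : List h} (hX : X.length + 1 ≠ m + n) :
    ins k q (ofWord Q) X (ofWord P) = 0 := by
  rw [ins_eq_sum]
  refine Finset.sum_eq_zero fun j hj =>
    (unsh_congr _ fun a b hab => ?_).trans (unsh_zero (k := k) _)
  rw [Finset.mem_range] at hj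
  rw [List.length_drop] at hab
  by_cases hb : b.length = n - 1
  · refine ofWord_of_length_ne P ?_
    simp only [List.length_append, List.length_map, List.length_take, List.length_cons]
    omega
  · rw [ofWord_of_length_ne Q (by simp only [List.length_cons]; omega)]
    exact (multiLin_ofWord P _ _).map_zero

theorem ofWord_diamondAux (α : h →ₗ[k] h) {m n N : ℕ} (hN : N + 1 = m + n) (hn : 1 ≤ n)
    (P : MultilinearMap k (fun _ : Fin m => h) h) (Q : MultilinearMap k (fun _ : Fin n => h) h)
    (X : List h) :
    ofWord (diamondAux α hN P Q) X = ins k (α ^ (n - 1)) (ofWord Q) X (ofWord P) := by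
  by_cases hX : X.length = N
  · obtain ⟨x, rfl⟩ := exists_word hX
    rw [ofWord_word, diamondAux_apply α hN hn]
  · rw [ofWord_of_length_ne _ hX, ins_ofWord_of_length_ne hn _ _ _ (by omega)]

theorem ofWord_add {m : ℕ} (P Q : MultilinearMap k (fun _ : Fin m => h) A) (X : List h) :
    ofWord (P + Q) X = ofWord P X + ofWord Q X := by
  simp only [ofWord]
  split_ifs <;> simp

theorem ofWord_smul {m : ℕ} (c : k) (P : MultilinearMap k (fun _ : Fin m => h) A) (X : List h) :
    ofWord (c • P) X = c • ofWord P X := by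
  simp only [ofWord]
  split_ifs <;> simp

theorem ofWord_sub {m : ℕ} (P Q : MultilinearMap k (fun _ : Fin m => h) A) (X : List h) :
    ofWord (P - Q) X = ofWord P X - ofWord Q X := by
  simp only [ofWord]
  split_ifs <;> simp

theorem pow_apply_comm (α : h →ₗ[k] h) (r s : ℕ) (x : h) :
    (α ^ r) ((α ^ s) x) = (α ^ s) ((α ^ r) x) := by
  rw [← Module.End.mul_apply, ← Module.End.mul_apply, ← pow_add, ← pow_add, add_comm]

theorem cochain_pow {α : h →ₗ[k] h} {β : A →ₗ[k] A} {n : ℕ} (f : Cochain α β n) (r : ℕ)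
    (x : Fin n → h) : (β ^ r) (f.1 x) = f.1 (fun i => (α ^ r) (x i)) := by
  induction r with
  | zero => simp
  | succ r ih =>
    rw [pow_succ', Module.End.mul_apply, ih, cochain_equivariant, pow_succ']
    rfl

theorem ofWord_balavoine (α : h →ₗ[k] h) {m n N : ℕ} (hN : N + 1 = m + n) (hm : 1 ≤ m)
    (hn : 1 ≤ n) (P : Cochain α α m) (Q : Cochain α α n) (X : List h) :
    ofWord (balavoine α hN P Q).1 X = ins k (α ^ (n - 1)) (ofWord Q.1) X (ofWord P.1)
      - (-1 : k) ^ ((m - 1) * (n - 1)) • ins k (α ^ (m - 1)) (ofWord P.1) X (ofWord Q.1) := by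
  rw [← ofWord_diamondAux α hN hn, ← ofWord_diamondAux α (hN.trans (Nat.add_comm m n)) hm,
    ← ofWord_smul, ← ofWord_sub]
  rfl

variable (k h) in
/-- The space of multilinear functions of words. -/
def wordFun : Submodule k (List h → h) where
  carrier := {f | MultiLin k f}
  add_mem' := MultiLin.add
  zero_mem' := MultiLin.zero
  smul_mem' c _ hf := MultiLin.smul hf c

/-- The operator on functions of words that inserts a cochain. -/
def insOp {α : h →ₗ[k] h} {m : ℕ} (P : Cochain α α m) : Module.End k (wordFun k h) where
  toFun f := ⟨fun X => ins k (α ^ (m - 1)) (ofWord P.1) X f.1, f.2.ins (multiLin_ofWord P.1)⟩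
  map_add' f g := Subtype.ext (funext fun X => ins_add _ _ X f.1 g.1)
  map_smul' c f := Subtype.ext (funext fun X => ins_smul _ _ X c f.1)

/-- This is `ins_ins` with `P` and `Q` exchanged. Insertion acts on the argument of `f`, which is
why `gradedComm` uses the opposite order. -/
theorem insOp_balavoine {α : h →ₗ[k] h} {m n N : ℕ} (hN : N + 1 = m + n) (hm : 1 ≤ m)
    (hn : 1 ≤ n) (P : Cochain α α m) (Q : Cochain α α n) :
    insOp (balavoine α hN P Q) = gradedComm k (m - 1) (n - 1) (insOp P) (insOp Q) := by
  refine LinearMap.ext fun f => Subtype.ext (funext fun X => ?_)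
  have key := ins_ins f.2 (multiLin_ofWord Q.1) (multiLin_ofWord P.1) (supported_ofWord hn Q.1)
    (supported_ofWord hm P.1) (pow_apply_comm α (n - 1) (m - 1))
    (fun X => ofWord_map (cochain_pow P (n - 1)) X) (fun X => ofWord_map (cochain_pow Q (m - 1)) X) X
  change ins k (α ^ (N - 1)) (ofWord (balavoine α hN P Q).1) X f.1
    = ins k (α ^ (n - 1)) (ofWord Q.1) X (fun a => ins k (α ^ (m - 1)) (ofWord P.1) a f.1)
      - (-1 : k) ^ ((m - 1) * (n - 1)) • ins k (α ^ (m - 1)) (ofWord P.1) X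
        (fun a => ins k (α ^ (n - 1)) (ofWord Q.1) a f.1)
  rw [mul_comm (m - 1), key, show N - 1 = (m - 1) + (n - 1) by omega, pow_add]
  congr 1
  funext Y
  rw [ofWord_balavoine α hN hm hn, mul_comm (m - 1)]

theorem ins_const_smul (q : h →ₗ[k] h) (Q : List h → h) (c : k) {f : List h → A}
    (hf : MultiLin k f) (X : List h) :
    ins k q (fun Y => c • Q Y) X f = c • ins k q Q X f := by
  induction X generalizing f with
  | nil => simp [ins]
  | cons x X ih =>
    rw [ins, ins, ih (hf.cons _), smul_add, ← unsh_smul]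
    congr 1
    exact unsh_congr _ fun a b _ => (hf.head _).map_smul _ _

theorem ins_fun_add (q : h →ₗ[k] h) (Q Q' : List h → h) {f : List h → A}
    (hf : MultiLin k f) (X : List h) :
    ins k q (fun Y => Q Y + Q' Y) X f = ins k q Q X f + ins k q Q' X f := by
  induction X generalizing f with
  | nil => simp [ins]
  | cons x X ih =>
    rw [ins, ins, ins, ih (hf.cons _), add_add_add_comm, ← unsh_add]
    congr 1
    exact unsh_congr _ fun a b _ => (hf.head _).map_add _ _

theorem insOp_smul {α : h →ₗ[k] h} {m : ℕ} (c : k) (P : Cochain α α m) :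
    insOp (c • P) = c • insOp P := by
  refine LinearMap.ext fun f => Subtype.ext (funext fun X => ?_)
  change ins k _ (ofWord (c • P.1)) X f.1 = c • ins k _ (ofWord P.1) X f.1
  rw [← ins_const_smul _ _ _ f.2]
  congr 1
  funext Y
  exact ofWord_smul c P.1 Y

theorem insOp_add {α : h →ₗ[k] h} {m : ℕ} (P Q : Cochain α α m) :
    insOp (P + Q) = insOp P + insOp Q := by
  refine LinearMap.ext fun f => Subtype.ext (funext fun X => ?_)
  change ins k _ (ofWord (P.1 + Q.1)) X f.1 = ins k _ (ofWord P.1) X f.1 + ins k _ (ofWord Q.1) X f.1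
  rw [← ins_fun_add _ _ _ f.2]
  congr 1
  funext Y
  exact ofWord_add P.1 Q.1 Y

theorem ins_of_length_le_one (q : h →ₗ[k] h) (Q : List h → h) (x : h) (X : List h)
    {f : List h → A} (hf : ∀ y z a, f (y :: z :: a) = 0) :
    ins k q Q (x :: X) f = f [Q (x :: X)] := by
  have h₀ : ∀ (X : List h) (g : List h → A), (∀ y a, g (y :: a) = 0) → ins k q Q X g = 0 := by
    intro X g hg
    cases X with
    | nil => rfl
    | cons x X => simp only [ins, hg, ins_zero, unsh_zero, add_zero]
  rw [ins, h₀ X _ fun y a => hf _ y a, zero_add, unsh_eq_of_left_nil]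
  · rfl
  · intro y a b
    rw [List.map_cons, hf]

theorem insOp_injective {α : h →ₗ[k] h} {m : ℕ} (hm : 1 ≤ m) {P Q : Cochain α α m}
    (e : insOp P = insOp Q) : P = Q := by
  -- The test function is the identity on one-letter words and 0 on the others: a word of length `m`
  -- contributes only when `P` consumes all of it.
  let f : wordFun k h := ⟨ofWord (MultilinearMap.ofSubsingleton k h h (0 : Fin 1) LinearMap.id),
    multiLin_ofWord _⟩
  have key : ∀ (P : Cochain α α m) (X : List h), X.length = m → (insOp P f).1 X = ofWord P.1 X := by
    intro P X hX
    obtain ⟨x, X, rfl⟩ : ∃ x Y, X = x :: Y := by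
      cases X with
      | nil => simp at hX; omega
      | cons x X => exact ⟨x, X, rfl⟩
    refine (ins_of_length_le_one _ _ _ _ fun y z a => ofWord_of_length_ne _ (by simp)).trans ?_
    simp [ofWord]
  refine Subtype.ext (MultilinearMap.ext fun x => ?_)
  rw [← ofWord_word P.1, ← ofWord_word Q.1, ← key P _ (length_word x), ← key Q _ (length_word x), e]

end Operators

/-! ### Derived brackets in an associative algebra. -/

section RingIdentities

variable {k E : Type*} [Field k] [Ring E] [Algebra k E]

/-- The derived bracket of operators of degrees `d` and `e` with respect to `x`. -/
def derivedComm (k : Type*) {E : Type*} [Field k] [Ring E] [Algebra k E] (x : E) (d e : ℕ)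
    (a b : E) : E :=
  (-1 : k) ^ d • gradedComm k (d + 1) e (gradedComm k 1 d x a) b

theorem mul_self_eq_zero_of_gradedComm [CharZero k] {x : E} (h : gradedComm k 1 1 x x = 0) :
    x * x = 0 := by
  rw [gradedComm, mul_one, pow_one, neg_smul, one_smul, sub_neg_eq_add, ← two_smul k] at h
  exact (smul_eq_zero.mp h).resolve_left two_ne_zero

theorem derivedComm_add_left (x : E) (d e : ℕ) (a a' b : E) :
    derivedComm k x d e (a + a') b = derivedComm k x d e a b + derivedComm k x d e a' b := by
  simp only [derivedComm, gradedComm, mul_add, add_mul, smul_add, smul_sub, mul_sub, sub_mul]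
  abel

theorem derivedComm_add_right (x : E) (d e : ℕ) (a b b' : E) :
    derivedComm k x d e a (b + b') = derivedComm k x d e a b + derivedComm k x d e a b' := by
  simp only [derivedComm, gradedComm, mul_add, add_mul, smul_add, smul_sub]
  abel

theorem derivedComm_smul_left (x : E) (d e : ℕ) (c : k) (a b : E) :
    derivedComm k x d e (c • a) b = c • derivedComm k x d e a b := by
  simp only [derivedComm, gradedComm, smul_sub, mul_sub, sub_mul, smul_mul_assoc,
    mul_smul_comm, smul_comm _ c]

theorem derivedComm_smul_right (x : E) (d e : ℕ) (c : k) (a b : E) :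
    derivedComm k x d e a (c • b) = c • derivedComm k x d e a b := by
  simp only [derivedComm, gradedComm, smul_sub, smul_mul_assoc, mul_smul_comm, smul_comm _ c]

/-- No commutation among `a`, `b`, `c` is needed. Signs depend only on the parities of the degrees,
and in each of the eight cases the identity is one of noncommutative polynomials modulo `x * x = 0`.
-/
theorem derivedComm_jacobi {x : E} (hx : x * x = 0) (d e f : ℕ) (a b c : E) :
    derivedComm k x d (e + f + 1) a (derivedComm k x e f b c)
      = derivedComm k x (d + e + 1) f (derivedComm k x d e a b) c
        + (-1 : k) ^ ((d + 1) * (e + 1)) •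
          derivedComm k x e (d + f + 1) b (derivedComm k x d f a c) := by
  have hx' : ∀ y, x * (x * y) = 0 := fun y => by rw [← mul_assoc, hx, zero_mul]
  simp only [derivedComm, gradedComm]
  rcases Nat.even_or_odd d with hd | hd <;> rcases Nat.even_or_odd e with he | he <;>
    rcases Nat.even_or_odd f with hf | hf <;>
    simp only [add_mul, mul_add, one_mul, mul_one, pow_add, pow_mul, hd.neg_one_pow,
      he.neg_one_pow, hf.neg_one_pow, one_pow, pow_one, one_smul, neg_smul, mul_neg,
      neg_neg, mul_sub, sub_mul, mul_assoc, hx, hx', mul_zero, zero_mul, neg_sub, sub_neg_eq_add,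
      add_mul, mul_add] <;>
    abel

/-- Here graded commutation of `a` and `b` is essential, and the square of `x` plays no role. -/
theorem derivedComm_skew {x a b : E} (d e : ℕ) (hab : b * a = (-1 : k) ^ (d * e) • (a * b)) :
    derivedComm k x d e a b = -((-1 : k) ^ ((d + 1) * (e + 1)) • derivedComm k x e d b a) := by
  have hab' : ∀ y, b * (a * y) = (-1 : k) ^ (d * e) • (a * (b * y)) := fun y => by
    rw [← mul_assoc, hab, smul_mul_assoc, mul_assoc]
  simp only [derivedComm, gradedComm]
  rcases Nat.even_or_odd d with hd | hd <;> rcases Nat.even_or_odd e with he | he <;>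
    simp only [add_mul, mul_add, one_mul, mul_one, pow_add, pow_mul, hd.neg_one_pow,
      he.neg_one_pow, one_pow, pow_one, one_smul, neg_smul, mul_neg,
      neg_neg, mul_sub, sub_mul, mul_assoc, hab, hab', neg_sub, sub_neg_eq_add,
      add_mul, mul_add] <;>
    abel

end RingIdentities

/-! ### The hemi-semidirect bracket, the abelian subalgebra, and weights. -/

section Hemi

variable {k g V : Type*} [Field k] [AddCommGroup g] [Module k g] [AddCommGroup V] [Module k V]
  {L : HomLieAlgebra k g} (R : Representation L V)

theorem diamondAux_apply_eq_sum {h : Type*} [AddCommGroup h] [Module k h] (α : h →ₗ[k] h)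
    {m n N : ℕ} (hN : N + 1 = m + n) (P : MultilinearMap k (fun _ : Fin m => h) h)
    (Q : MultilinearMap k (fun _ : Fin n => h) h) (x : Fin N → h) :
    diamondAux α hN P Q x = ∑ i : Fin m, ∑ σ ∈ shuffles N i (n - 1),
      ((-1 : ℤˣ) ^ ((i : ℕ) * (n - 1)) * Equiv.Perm.sign σ) •
        P (insertArgs α hN Q i fun c => x (σ c)) := by
  simp only [diamondAux, sum_apply]
  rfl

theorem eq_zero_of_two_pow_smul_eq [CharZero k] {A : Type*} [AddCommGroup A] [Module k A] {r s : ℕ}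
    (hrs : r ≠ s) {a : A} (h : (2 : k) ^ r • a = (2 : k) ^ s • a) : a = 0 := by
  rw [← sub_eq_zero, ← sub_smul, smul_eq_zero, sub_eq_zero] at h
  refine h.resolve_left fun h' => hrs ?_
  exact Nat.pow_right_injective le_rfl (by exact_mod_cast h')

namespace Representation

theorem sumTwist_pow_apply (r : ℕ) (z : g × V) :
    (R.sumTwist ^ r) z = ((L.twist ^ r) z.1, (R.twist ^ r) z.2) := by
  induction r with
  | zero => rfl
  | succ r ih =>
    rw [pow_succ', pow_succ', pow_succ', Module.End.mul_apply, ih]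
    rfl

theorem incl_apply {n : ℕ} (P : Cochain R.twist L.twist n) (z : Fin n → g × V) :
    (R.incl P).1 z = (P.1 fun i => (z i).2, 0) :=
  rfl

theorem ofWord_incl {n : ℕ} (P : Cochain R.twist L.twist n) (X : List (g × V)) :
    ofWord (R.incl P).1 X = (ofWord P.1 (X.map Prod.snd), 0) := by
  by_cases hX : X.length = n
  · obtain ⟨x, rfl⟩ := exists_word hX
    rw [ofWord_word, map_word, ofWord_word]
    rfl
  · rw [ofWord_of_length_ne _ hX, ofWord_of_length_ne _ (by simpa using hX)]
    rfl

theorem incl_injective {n : ℕ} {P Q : Cochain R.twist L.twist n} (h : R.incl P = R.incl Q) :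
    P = Q := by
  refine Subtype.ext (MultilinearMap.ext fun v => ?_)
  have := congrArg (fun f => (f.1 fun i => ((0 : g), v i)).1) h
  exact this

theorem incl_add {n : ℕ} (P Q : Cochain R.twist L.twist n) :
    R.incl (P + Q) = R.incl P + R.incl Q :=
  Subtype.ext (MultilinearMap.ext fun _ => Prod.ext rfl (add_zero _).symm)

theorem incl_smul {n : ℕ} (c : k) (P : Cochain R.twist L.twist n) :
    R.incl (c • P) = c • R.incl P :=
  Subtype.ext (MultilinearMap.ext fun _ => Prod.ext rfl (smul_zero c).symm)

theorem ofWord_hemi (x y : g × V) :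
    ofWord R.hemi.1 [y, x] = (L.bracket x.1 y.1, R.rho x.1 y.2) := by
  rw [ofWord, if_pos (by simp)]
  rfl

/-- The `g`-component is the Hom-Jacobi identity and the `V`-component is the compatibility of `rho`
with the bracket. -/
theorem diamond_hemi_hemi : diamond R.sumTwist (m := 2) (n := 2) (N := 3) rfl R.hemi R.hemi = 0 := by
  refine Subtype.ext (MultilinearMap.ext fun z => ?_)
  change diamondAux R.sumTwist (m := 2) (n := 2) (N := 3) rfl R.hemi.1 R.hemi.1 z = 0
  rw [diamondAux_apply _ _ (by norm_num)]
  have e : word z = [z 2, z 1, z 0] := rfl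
  have h₁ : ∀ a, ofWord R.hemi.1 [a] = 0 := fun a => ofWord_of_length_ne _ (by simp)
  have h₃ : ∀ a b c, ofWord R.hemi.1 [a, b, c] = 0 := fun a b c => ofWord_of_length_ne _ (by simp)
  rw [e]
  simp only [ins, unsh, List.map_cons, List.map_nil, h₁, h₃, List.length_cons, List.length_nil, ofWord_hemi]
  have j := L.hom_jacobi (z 0).1 (z 1).1 (z 2).1
  have a := R.action (z 0).1 (z 1).1 (z 2).2
  rw [L.skew (z 2).1 (z 0).1, map_neg] at j
  refine Prod.ext ?_ ?_
  · simp
    rw [L.skew _ (L.twist (z 2).1)]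
    refine Eq.trans ?_ (neg_eq_zero.mpr j)
    abel
  · simp
    rw [← a]
    abel

theorem insOp_hemi_mul_self [CharZero k] : insOp R.hemi * insOp R.hemi = 0 := by
  -- Zero is written as a multiple by the scalar 0 so that `insOp_smul` shows its operator to
  -- vanish.
  have h₀ : balavoine R.sumTwist (m := 2) (n := 2) (N := 3) rfl R.hemi R.hemi = (0 : k) • 0 := by
    rw [balavoine, diamond_hemi_hemi, smul_zero, zero_smul]
    exact sub_zero (0 : Cochain R.sumTwist R.sumTwist _)
  have h := insOp_balavoine (m := 2) (n := 2) (N := 3) rfl (by norm_num) (by norm_num) R.hemi R.hemi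
  rw [h₀, insOp_smul, zero_smul] at h
  exact mul_self_eq_zero_of_gradedComm (k := k) h.symm

/-- The inserted value lies in `g ⊕ 0`, and the outer map sees only its `V`-component. -/
theorem diamond_incl_incl {m n N : ℕ} (hN : N + 1 = m + n) (P : Cochain R.twist L.twist m)
    (Q : Cochain R.twist L.twist n) : diamond R.sumTwist hN (R.incl P) (R.incl Q) = 0 := by
  refine Subtype.ext (MultilinearMap.ext fun z => ?_)
  change diamondAux R.sumTwist hN (R.incl P).1 (R.incl Q).1 z = 0
  rw [diamondAux_apply_eq_sum]
  refine Finset.sum_eq_zero fun i _ => Finset.sum_eq_zero fun σ _ => ?_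
  rw [incl_apply, P.1.map_coord_zero i]
  · exact smul_zero _
  · simp [insertArgs, incl_apply]

theorem insOp_incl_mul {m n : ℕ} (hm : 1 ≤ m) (hn : 1 ≤ n) (P : Cochain R.twist L.twist m)
    (Q : Cochain R.twist L.twist n) :
    insOp (R.incl Q) * insOp (R.incl P)
      = (-1 : k) ^ ((m - 1) * (n - 1)) • (insOp (R.incl P) * insOp (R.incl Q)) := by
  have hN : m + n - 1 + 1 = m + n := by omega
  have h₀ : balavoine R.sumTwist hN (R.incl P) (R.incl Q) = (0 : k) • 0 := by
    rw [balavoine, diamond_incl_incl, diamond_incl_incl, smul_zero, zero_smul]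
    exact sub_zero (0 : Cochain R.sumTwist R.sumTwist _)
  have h := insOp_balavoine hN hm hn (R.incl P) (R.incl Q)
  rw [h₀, insOp_smul, zero_smul] at h
  exact sub_eq_zero.mp h.symm

theorem insOp_derived {m n N : ℕ} (hN : N = m + n) (hm : 1 ≤ m) (hn : 1 ≤ n)
    (P : Cochain R.twist L.twist m) (Q : Cochain R.twist L.twist n) :
    insOp (R.derived hN P Q)
      = derivedComm k (insOp R.hemi) (m - 1) (n - 1) (insOp (R.incl P)) (insOp (R.incl Q)) := by
  rw [derived, insOp_smul, insOp_balavoine _ (by omega) hn, insOp_balavoine _ (by omega) hm]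
  rw [derivedComm, show m + 1 - 1 = m - 1 + 1 by omega]

/-- The automorphism of `g ⊕ V` that doubles the elements of `V`. -/
def scale (k g V : Type*) [Field k] [AddCommGroup g] [Module k g] [AddCommGroup V] [Module k V] :
    (g × V) →ₗ[k] (g × V) :=
  LinearMap.id.prodMap ((2 : k) • LinearMap.id)

theorem scale_apply (z : g × V) : scale k g V z = (z.1, (2 : k) • z.2) := rfl

theorem scale_sumTwist_pow (r : ℕ) (z : g × V) :
    (R.sumTwist ^ r) (scale k g V z) = scale k g V ((R.sumTwist ^ r) z) := by
  simp [sumTwist_pow_apply, scale_apply]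

/-- `f` has weight `w` if it lowers the number of elements of `V` by `w`. -/
def HasWeight {n : ℕ} (f : MultilinearMap k (fun _ : Fin n => g × V) (g × V)) (w : ℕ) : Prop :=
  ∀ z, f (fun i => scale k g V (z i)) = (2 : k) ^ w • scale k g V (f z)

theorem HasWeight.diamondAux {m n N u w : ℕ} (hN : N + 1 = m + n)
    {P : MultilinearMap k (fun _ : Fin m => g × V) (g × V)}
    {Q : MultilinearMap k (fun _ : Fin n => g × V) (g × V)} (hP : HasWeight P u)
    (hQ : HasWeight Q w) : HasWeight (HomLie.diamondAux R.sumTwist hN P Q) (u + w) := by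
  intro z
  simp only [diamondAux_apply_eq_sum, map_sum, Finset.smul_sum]
  refine Finset.sum_congr rfl fun i _ => Finset.sum_congr rfl fun σ _ => ?_
  -- Powers of the twist commute with `scale`, so only the slot holding the value of `Q` acquires an
  -- extra factor, which multilinearity pulls out.
  have e : (insertArgs R.sumTwist hN Q i fun c => scale k g V (z (σ c)))
      = Function.update (fun j => scale k g V (insertArgs R.sumTwist hN Q i (fun c => z (σ c)) j)) i
        ((2 : k) ^ w • scale k g V (insertArgs R.sumTwist hN Q i (fun c => z (σ c)) i)) := by
    funext j
    by_cases hj : j = i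
    · subst hj
      rw [Function.update_self]
      simp only [insertArgs, lt_irrefl, dite_false, dite_true]
      exact hQ _
    · rw [Function.update_of_ne hj]
      simp only [insertArgs, hj, dite_false]
      split_ifs <;> exact R.scale_sumTwist_pow _ _
  rw [e, P.map_update_smul, Function.update_eq_self, hP, smul_smul, ← pow_add, add_comm w]
  rw [units_smul (k := k), units_smul (k := k), map_smul, smul_comm]

theorem HasWeight.balavoine {m n N u w : ℕ} (hN : N + 1 = m + n)
    {P : Cochain R.sumTwist R.sumTwist m} {Q : Cochain R.sumTwist R.sumTwist n}
    (hP : HasWeight P.1 u) (hQ : HasWeight Q.1 w) :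
    HasWeight (HomLie.balavoine R.sumTwist hN P Q).1 (u + w) := by
  intro z
  have h₁ := HasWeight.diamondAux R hN hP hQ z
  have h₂ := HasWeight.diamondAux R (hN.trans (Nat.add_comm m n)) hQ hP z
  have e : ∀ z, (HomLie.balavoine R.sumTwist hN P Q).1 z
      = HomLie.diamondAux R.sumTwist hN P.1 Q.1 z - (-1 : k) ^ ((m - 1) * (n - 1)) •
        HomLie.diamondAux R.sumTwist (hN.trans (Nat.add_comm m n)) Q.1 P.1 z := fun _ => rfl
  rw [e, e, h₁, h₂, map_sub, map_smul, smul_sub, add_comm w, smul_comm]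

theorem hasWeight_hemi : HasWeight R.hemi.1 0 := fun z => by
  refine Prod.ext ?_ ?_
  · change L.bracket _ _ = ((2 : k) ^ 0 • scale k g V _).1
    simp [scale_apply]
    rfl
  · change R.rho (z 0).1 ((2 : k) • (z 1).2) = (2 : k) ^ 0 • (2 : k) • R.rho (z 0).1 (z 1).2
    simp

theorem hasWeight_incl {n : ℕ} (P : Cochain R.twist L.twist n) : HasWeight (R.incl P).1 n := by
  intro z
  rw [incl_apply, incl_apply, scale_apply]
  refine Prod.ext ?_ (by simp)
  have := P.1.map_smul_univ (fun _ => (2 : k)) (fun i => (z i).2)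
  simpa [scale_apply] using this

theorem hasWeight_derived {m n N : ℕ} (hN : N = m + n) (P : Cochain R.twist L.twist m)
    (Q : Cochain R.twist L.twist n) : HasWeight (R.derived hN P Q).1 N := by
  intro z
  have h := HasWeight.balavoine R (show N + 1 = m + 1 + n by omega)
    (HasWeight.balavoine R (show m + 1 + 1 = 2 + m by omega) R.hasWeight_hemi (R.hasWeight_incl P))
    (R.hasWeight_incl Q) z
  rw [zero_add, ← hN] at h
  have e : ∀ z, (R.derived hN P Q).1 z = (-1 : k) ^ (m - 1) •
      (HomLie.balavoine R.sumTwist (show N + 1 = m + 1 + n by omega)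
        (HomLie.balavoine R.sumTwist (m := 2) (n := m) (N := m + 1) (by omega) R.hemi (R.incl P))
        (R.incl Q)).1 z := fun _ => rfl
  rw [e, e, map_smul, smul_comm, h]

/-- The restriction of a cochain to `V`, with its values projected to `g`. -/
def restr {n : ℕ} (f : Cochain R.sumTwist R.sumTwist n) : Cochain R.twist L.twist n where
  val := (LinearMap.fst k g V).compMultilinearMap (f.1.compLinearMap fun _ => LinearMap.inr k g V)
  property := by
    intro v
    have := congrArg Prod.fst (cochain_equivariant f fun i => ((0 : g), v i))
    simpa using this

theorem restr_apply {n : ℕ} (f : Cochain R.sumTwist R.sumTwist n) (v : Fin n → V) :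
    (R.restr f).1 v = (f.1 fun i => ((0 : g), v i)).1 :=
  rfl

/-- Expand `f` by multilinearity over the set `s` of slots filled from `g`. Scaling the inputs gives
`2 ^ (n - s.card)`, whereas weight `n` demands `2 ^ n` on the `g`-component and `2 ^ (n + 1)` on the
`V`-component; hence only the `g`-component with `s = ∅` survives. -/
theorem incl_restr [CharZero k] {n : ℕ} {f : Cochain R.sumTwist R.sumTwist n}
    (hf : HasWeight f.1 n) : R.incl (R.restr f) = f := by
  refine Subtype.ext (MultilinearMap.ext fun z => ?_)
  have key : ∀ s : Finset (Fin n), f.1 (s.piecewise (fun i => ((z i).1, 0)) fun i => (0, (z i).2))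
      = if s = ∅ then ((f.1 fun i => ((0 : g), (z i).2)).1, 0) else 0 := by
    intro s
    set y := s.piecewise (fun i => ((z i).1, (0 : V))) fun i => ((0 : g), (z i).2) with hy
    have e : (fun i => scale k g V (y i)) = fun i => (if i ∈ s then (1 : k) else 2) • y i := by
      funext i
      by_cases hi : i ∈ s <;> simp [hy, hi, scale_apply]
    have hw := hf y
    rw [e, f.1.map_smul_univ] at hw
    have hp : (∏ i, if i ∈ s then (1 : k) else 2) = 2 ^ (n - s.card) := by
      rw [Finset.prod_ite]
      simp [Finset.filter_not, Finset.card_sdiff]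
    rw [hp] at hw
    have hs : s.card ≤ n := by simpa using s.card_le_univ
    have hsnd : (f.1 y).2 = 0 := by
      refine eq_zero_of_two_pow_smul_eq (k := k) (r := n - s.card) (s := n + 1) (by omega) ?_
      have := congrArg Prod.snd hw
      rw [pow_succ, mul_smul]
      exact this
    split_ifs with h
    · refine Prod.ext ?_ hsnd
      subst h
      rw [hy, Finset.piecewise_empty]
    · refine Prod.ext ?_ hsnd
      have : 0 < s.card := Finset.card_pos.mpr (Finset.nonempty_iff_ne_empty.mpr h)
      exact eq_zero_of_two_pow_smul_eq (k := k) (r := n - s.card) (s := n) (by omega) (congrArg Prod.fst hw)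
  have hz : z = (fun i => ((z i).1, (0 : V))) + fun i => ((0 : g), (z i).2) := by
    funext i
    simp
  conv_rhs => rw [hz, f.1.map_add_univ]
  simp only [key]
  rw [Finset.sum_ite_eq' Finset.univ]
  simp [incl_apply, restr_apply]

theorem incl_restr_derived [CharZero k] {m n N : ℕ} (hN : N = m + n)
    (P : Cochain R.twist L.twist m) (Q : Cochain R.twist L.twist n) :
    R.incl (R.restr (R.derived hN P Q)) = R.derived hN P Q :=
  R.incl_restr (R.hasWeight_derived hN P Q)

end Representation

end Hemi

/-! ### The explicit formula for the bracket. -/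

section Explicit

variable {k g V : Type*} [Field k] [AddCommGroup g] [Module k g] [AddCommGroup V] [Module k V]
  {L : HomLieAlgebra k g} (R : Representation L V)

theorem neg_neg_one_pow (a : ℕ) : -(-1 : k) ^ a = (-1 : k) ^ (a + 1) := by
  rw [pow_succ, mul_neg_one]

theorem ins_eq_zero {h A : Type*} [AddCommGroup h] [Module k h] [AddCommGroup A] [Module k A]
    (q : h →ₗ[k] h) (Q : List h → h) (X : List h) {f : List h → A}
    (hf : ∀ a b c, f (a ++ Q b :: c) = 0) : ins k q Q X f = 0 := by
  rw [ins_eq_sum]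
  refine Finset.sum_eq_zero fun j _ => (unsh_congr _ fun a b _ => hf _ _ _).trans ?_
  exact unsh_zero (k := k) _

namespace Representation

theorem ofWord_hemi_of_length_ne {X : List (g × V)} (hX : X.length ≠ 2) :
    ofWord R.hemi.1 X = 0 :=
  ofWord_of_length_ne _ hX

theorem ofWord_incl_eq_zero {m : ℕ} (P : Cochain R.twist L.twist m) (a c : List (g × V))
    {z : g × V} (hz : z.2 = 0) : ofWord (R.incl P).1 (a ++ z :: c) = 0 := by
  rw [ofWord_incl, List.map_append, List.map_cons, hz, (multiLin_ofWord P.1 _ _).map_zero]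
  rfl

theorem ofWord_incl_ofWord_incl {m n : ℕ} (P : Cochain R.twist L.twist m)
    (Q : Cochain R.twist L.twist n) (a b c : List (g × V)) :
    ofWord (R.incl P).1 (a ++ ofWord (R.incl Q).1 b :: c) = 0 :=
  R.ofWord_incl_eq_zero P _ _ (by rw [ofWord_incl])

theorem ins_incl_hemi {m : ℕ} (hm : 1 ≤ m) (P : Cochain R.twist L.twist m) (q : (g × V) →ₗ[k] g × V)
    (x : g × V) (X : List (g × V)) :
    ins k q (ofWord (R.incl P).1) (x :: X) (ofWord R.hemi.1)
      = ofWord R.hemi.1 [q x, ofWord (R.incl P).1 X]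
        + unsh k X (fun a b => ofWord R.hemi.1 (ofWord (R.incl P).1 (x :: b) :: a.map q)) := by
  rw [ins]
  congr 1
  cases X with
  | nil =>
    have : ofWord (R.incl P).1 [] = 0 := ofWord_of_length_ne _ (by simp; omega)
    rw [this]
    exact ((multiLin_ofWord R.hemi.1).cons (q x) [] []).map_zero.symm
  | cons y X =>
    exact ins_of_length_le_one _ _ _ _ fun y z a => ofWord_of_length_ne _ (by simp)

/-- Only `Q` placed in the first slot of `π` contributes: in the second slot its `V`-component 0 is
acted upon, and `Q ⋄ π` takes values in `g`. -/
theorem balavoine_hemi_incl_snd {n N : ℕ} (hn : 1 ≤ n) (hN : N + 1 = 2 + n)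
    (Q : Cochain R.twist L.twist n) (w : Fin N → V) :
    ((balavoine R.sumTwist hN R.hemi (R.incl Q)).1 fun l => ((0 : g), w l)).2
      = R.rho (Q.1 fun l => w ⟨l, by omega⟩) ((R.twist ^ (n - 1)) (w ⟨n, by omega⟩)) := by
  obtain rfl : N = n + 1 := by omega
  rw [← ofWord_word, ofWord_balavoine _ _ (by norm_num) hn, word_succ, R.ins_incl_hemi hn]
  have h₁ : (ins k (R.sumTwist ^ (2 - 1)) (ofWord R.hemi.1)
      (((0 : g), w (Fin.last n)) :: word fun i : Fin n => ((0 : g), w i.castSucc))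
      (ofWord (R.incl Q).1)).2 = 0 := by
    have := map_ins (k := k) (R.sumTwist ^ (2 - 1)) (ofWord R.hemi.1) (LinearMap.snd k g V)
      (((0 : g), w (Fin.last n)) :: word fun i : Fin n => ((0 : g), w i.castSucc))
      (ofWord (R.incl Q).1)
    rw [LinearMap.snd_apply] at this
    rw [this]
    simp only [LinearMap.snd_apply, ofWord_incl]
    exact ins_zero _ _ _
  have h₂ : ∀ (X : List (g × V)) (x : g × V), (unsh k X fun a b => ofWord R.hemi.1
      (ofWord (R.incl Q).1 (x :: b) :: a.map (R.sumTwist ^ (n - 1)))).2 = 0 := by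
    intro X x
    have := map_unsh (LinearMap.snd k g V) X fun a b => ofWord R.hemi.1
      (ofWord (R.incl Q).1 (x :: b) :: a.map (R.sumTwist ^ (n - 1)))
    rw [LinearMap.snd_apply] at this
    rw [this]
    refine (unsh_congr _ fun a b _ => ?_).trans (unsh_zero (k := k) X)
    rw [ofWord_incl, LinearMap.snd_apply]
    rcases a with _ | ⟨y, _ | ⟨z, a⟩⟩
    · rw [R.ofWord_hemi_of_length_ne (by simp)]; rfl
    · exact (congrArg Prod.snd (R.ofWord_hemi _ _)).trans (map_zero (R.rho _))
    · rw [R.ofWord_hemi_of_length_ne (by simp)]; rfl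
  rw [Prod.snd_sub, Prod.smul_snd, h₁, smul_zero, sub_zero, Prod.snd_add, h₂, add_zero, ofWord_hemi,
    ofWord_incl, map_word, ofWord_word, sumTwist_pow_apply]
  rfl

/-- `P` reads only the `V`-component of the inserted `[π, Q]_B`. That map has arity `n + 1`, whence
the `(i, n)`-shuffles and the twist `β ^ n`. -/
theorem diamondAux_incl_balavoine {m n N : ℕ} (hn : 1 ≤ n) (hN : N = m + n)
    (P : Cochain R.twist L.twist m) (Q : Cochain R.twist L.twist n) (v : Fin N → V) :
    (diamondAux R.sumTwist (n := n + 1) (show N + 1 = m + (n + 1) by omega) (R.incl P).1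
      (balavoine R.sumTwist (m := 2) (n := n) (N := n + 1) (by omega) R.hemi (R.incl Q)).1
      fun i => ((0 : g), v i)).1 = -R.halfSum hN P Q v := by
  rw [diamondAux_apply_eq_sum, Prod.fst_sum, halfSum, ← Finset.sum_neg_distrib]
  refine Finset.sum_congr rfl fun i _ => ?_
  rw [Prod.fst_sum, ← Finset.sum_neg_distrib]
  refine Finset.sum_congr rfl fun σ hσ => ?_
  have hfix := (mem_shuffles.mp hσ).2.2
  rw [Prod.smul_fst, incl_apply, pow_succ, mul_neg_one, neg_mul, Units.neg_smul, neg_neg]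
  refine congrArg (fun w => (_ : ℤˣ) • P.1 w) (funext fun j => ?_)
  simp only [insertArgs]
  split_ifs with h₁ h₂
  · rw [sumTwist_pow_apply]
    rfl
  · rw [R.balavoine_hemi_incl_snd hn]
    congr 3
    exact hfix _ (by simp)
  · rw [Fin.lt_def] at h₁
    rw [Fin.ext_iff] at h₂
    have e := hfix ⟨(j : ℕ) + (n + 1) - 1, by omega⟩
      (show (i : ℕ) + n ≤ (j : ℕ) + (n + 1) - 1 by omega)
    rw [sumTwist_pow_apply, e]
    rfl

/-- Nested insertions vanish, so `P` and `Q` occupy the two slots of `π`. If the last letter belongs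
to `Q` this gives `[P, Q]`, if to `P` it gives `[Q, P]`; skew symmetry of the bracket merges the two
families into one unshuffle. -/
theorem ins_ins_hemi_fst {m n : ℕ} (hm : 1 ≤ m) (hn : 1 ≤ n) (P : Cochain R.twist L.twist m)
    (Q : Cochain R.twist L.twist n) {p q : (g × V) →ₗ[k] g × V} (X : List (g × V)) :
    (ins k q (ofWord (R.incl Q).1) X fun a => ins k p (ofWord (R.incl P).1) a (ofWord R.hemi.1)).1
      = (-1 : k) ^ m • unsh k X fun a b =>
        L.bracket (ofWord (R.incl P).1 (a.map q)).1 (p (ofWord (R.incl Q).1 b)).1 := by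
  have hQ₀ : ∀ a b c, ofWord (R.incl P).1 (a ++ ofWord (R.incl Q).1 b :: c) = 0 :=
    R.ofWord_incl_ofWord_incl P Q
  have hφ := map_ins (k := k) q (ofWord (R.incl Q).1) (LinearMap.fst k g V) X
    fun a => ins k p (ofWord (R.incl P).1) a (ofWord R.hemi.1)
  simp only [LinearMap.fst_apply] at hφ
  rw [hφ]
  cases X with
  | nil =>
    have : ofWord (R.incl P).1 [] = 0 := ofWord_of_length_ne _ (by simp; omega)
    simp [ins, unsh, this]
  | cons y Y =>
    have hπ₀ : ∀ a, ofWord R.hemi.1 (0 :: a) = 0 := (multiLin_ofWord R.hemi.1).head_zero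
    have hπ₁ : ∀ x, ofWord R.hemi.1 [x, 0] = 0 := fun x => by simp [ofWord_hemi]
    have e₁ : ∀ a b : List (g × V), (ins k p (ofWord (R.incl P).1)
        (ofWord (R.incl Q).1 (y :: b) :: a.map q) (ofWord R.hemi.1)).1
        = L.bracket (ofWord (R.incl P).1 (a.map q)).1 (p (ofWord (R.incl Q).1 (y :: b))).1 := by
      intro a b
      rw [R.ins_incl_hemi hm, ofWord_hemi]
      have e₀ : ∀ d, ofWord (R.incl P).1 (ofWord (R.incl Q).1 (y :: b) :: d) = 0 := hQ₀ [] (y :: b)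
      simp only [e₀, hπ₀, unsh_zero, add_zero]
    let G : List (g × V) → List (g × V) → g := fun c d =>
      (ofWord R.hemi.1 (ofWord (R.incl P).1 (q y :: d) :: c.map p)).1
    have e₂ : ∀ a, (ins k p (ofWord (R.incl P).1) (q y :: a) (ofWord R.hemi.1)).1
        = (ofWord R.hemi.1 [p (q y), ofWord (R.incl P).1 a]).1 + unsh k a G := by
      intro a
      rw [R.ins_incl_hemi hm, Prod.fst_add]
      congr 1
      exact map_unsh (LinearMap.fst k g V) a _
    have e₃ : ∀ a b : List (g × V), ins k q (ofWord (R.incl Q).1) a (fun c => G c (b.map q))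
        = L.bracket (p (ofWord (R.incl Q).1 a)).1 (ofWord (R.incl P).1 ((y :: b).map q)).1 := by
      intro a b
      cases a with
      | nil =>
        have : ofWord (R.incl Q).1 [] = 0 := ofWord_of_length_ne _ (by simp; omega)
        rw [this, map_zero]
        exact (LinearMap.map_zero₂ _ _).symm
      | cons x a =>
        rw [ins_of_length_le_one]
        · simp only [G, List.map_cons, List.map_nil, ofWord_hemi]
        · intro y z c
          simp only [G]
          rw [R.ofWord_hemi_of_length_ne (by simp)]
          rfl
    have e₄ : ∀ a b : List (g × V), ins k q (ofWord (R.incl Q).1) b (fun c => G (a.map q) c) = 0 := by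
      intro a b
      refine ins_eq_zero _ _ _ fun c d e => ?_
      simp only [G]
      rw [← List.cons_append, hQ₀, hπ₀]
      rfl
    have e₅ : ins k q (ofWord (R.incl Q).1) Y
        (fun a => (ofWord R.hemi.1 [p (q y), ofWord (R.incl P).1 a]).1) = 0 :=
      ins_eq_zero _ _ _ fun c d e => by rw [hQ₀, hπ₁]; rfl
    have hG₁ : ∀ d, MultiLin k fun c => G c d := fun d =>
      (((multiLin_ofWord R.hemi.1).cons _).map p).comp (LinearMap.fst k g V)
    have hG₂ : ∀ c, MultiLin k fun d => G c d := fun c =>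
      ((multiLin_ofWord (R.incl P).1).cons (q y)).comp
        (LinearMap.fst k g V ∘ₗ ((multiLin_ofWord R.hemi.1).head (c.map p)).mk' _)
    rw [ins]
    simp only [e₁, e₂, ins_add, e₅, zero_add]
    rw [ins_unsh (supported_ofWord hn _) Y hG₁ hG₂]
    simp only [e₃, e₄, unsh_zero, add_zero]
    -- The target splits according to the subword receiving the last letter, matching the two
    -- families; `unsh_comm` reorders the one with `Q` in front.
    rw [unsh, smul_add, ← unsh_smul, ← unsh_smul, unsh_comm]
    congr 1
    · refine unsh_congr _ fun a b _ => ?_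
      by_cases hb : b.length = n
      · by_cases ha : a.length + 1 = m
        · rw [L.skew, smul_neg, smul_neg, ← neg_smul, smul_smul, hb]
          congr 1
          rw [← ha]
          obtain ⟨n, rfl⟩ : ∃ c, n = c + 1 := ⟨n - 1, by omega⟩
          rw [Nat.add_sub_cancel, neg_mul, ← pow_add, neg_neg_one_pow]
          refine neg_one_pow_congr ?_
          simp only [Nat.even_add, Nat.even_mul, Nat.not_even_one]
          tauto
        · rw [ofWord_of_length_ne (R.incl P).1 (by simpa using ha)]
          simp
      · rw [ofWord_of_length_ne (R.incl Q).1 hb]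
        simp
    · refine unsh_congr _ fun a b _ => ?_
      by_cases ha : a.length = m
      · rw [ha, smul_smul, ← mul_pow]
        simp
      · rw [ofWord_of_length_ne (R.incl P).1 (by simpa using ha)]
        simp

/-- The exponent `m * n + 1` is the shuffle sign with one extra minus; equivariance of `Q` moves the
twist from its arguments to its value. -/
theorem bracketSum_eq_unsh {m n N : ℕ} (hN : N = m + n)
    (P : Cochain R.twist L.twist m) (Q : Cochain R.twist L.twist n) (v : Fin N → V) :
    R.bracketSum hN P Q v = -unsh k (word fun i => ((0 : g), v i)) fun a b =>
      L.bracket (ofWord (R.incl P).1 (a.map (R.sumTwist ^ (n - 1)))).1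
        ((R.sumTwist ^ (m - 1)) (ofWord (R.incl Q).1 b)).1 := by
  have e := sum_shuffles_eq_unsh (k := k) (a := m) (b := n) hN.symm (fun i => ((0 : g), v i))
    fun W => L.bracket (ofWord (R.incl P).1 ((W.drop n).map (R.sumTwist ^ (n - 1)))).1
        ((R.sumTwist ^ (m - 1)) (ofWord (R.incl Q).1 (W.take n))).1
  have e' : (unsh k (word fun i => ((0 : g), v i)) fun a b =>
      L.bracket (ofWord (R.incl P).1 (a.map (R.sumTwist ^ (n - 1)))).1
        ((R.sumTwist ^ (m - 1)) (ofWord (R.incl Q).1 b)).1) = _ :=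
    (unsh_congr _ fun a b hab => ?_).trans e.symm
  · rw [e', bracketSum, ← Finset.sum_neg_distrib]
    refine Finset.sum_congr rfl fun σ _ => ?_
    rw [pow_succ, mul_neg_one, neg_mul, Units.neg_smul]
    congr 3
    · have d : ((word fun i => ((0 : g), v (σ i))).drop n)
          = word fun j : Fin m => ((0 : g), v (σ ⟨j, by omega⟩)) := by
        refine List.ext_getElem (by simp; omega) fun i h₁ h₂ => ?_
        rw [length_word] at h₂
        rw [List.getElem_drop, word_getElem, word_getElem]
        congr 4
        simp only
        omega
      rw [d, map_word, ofWord_word, incl_apply]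
      simp only [sumTwist_pow_apply]
    · have d : ((word fun i => ((0 : g), v (σ i))).take n)
          = word fun j : Fin n => ((0 : g), v (σ ⟨m + j, by omega⟩)) := by
        refine List.ext_getElem (by simp; omega) fun i h₁ h₂ => ?_
        rw [length_word] at h₂
        rw [List.getElem_take, word_getElem, word_getElem]
        congr 4
        simp only
        omega
      rw [d, ofWord_word, incl_apply, sumTwist_pow_apply]
      exact (cochain_pow Q _ _).symm
  · rw [length_word] at hab
    split_ifs with ha
    · have hb : b.length = n := by omega
      rw [List.drop_left' hb, List.take_left' hb]
    · rw [ofWord_of_length_ne _ (by simpa using ha)]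
      exact LinearMap.map_zero₂ _ _

theorem derived_fst {m n N : ℕ} (hN : N = m + n) (hm : 1 ≤ m) (hn : 1 ≤ n)
    (P : Cochain R.twist L.twist m) (Q : Cochain R.twist L.twist n) (v : Fin N → V) :
    ((R.derived hN P Q).1 fun i => ((0 : g), v i)).1
      = R.halfSum hN P Q v - (-1 : k) ^ (m * n) • R.halfSum (hN.trans (Nat.add_comm m n)) Q P v
        + R.bracketSum hN P Q v := by
  set z : Fin N → g × V := fun i => ((0 : g), v i) with hz
  set piP := balavoine R.sumTwist (m := 2) (n := m) (N := m + 1) (by omega) R.hemi (R.incl P)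
    with hpiP
  set piQ := balavoine R.sumTwist (m := 2) (n := n) (N := n + 1) (by omega) R.hemi (R.incl Q)
    with hpiQ
  have d₀ : (R.derived hN P Q).1 z = (-1 : k) ^ (m - 1) •
      (balavoine R.sumTwist (show N + 1 = m + 1 + n by omega) piP (R.incl Q)).1 z := rfl
  have wA : ofWord piP.1 = fun X =>
      ins k (R.sumTwist ^ (m - 1)) (ofWord (R.incl P).1) X (ofWord R.hemi.1)
        + (-(-1 : k) ^ (m - 1)) • ins k (R.sumTwist ^ 1) (ofWord R.hemi.1) X (ofWord (R.incl P).1) := by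
    funext X
    rw [hpiP, ofWord_balavoine _ _ (by norm_num) hm, neg_smul, sub_eq_add_neg]
    simp
  -- As `P ⋄ Q = 0`, one of the two composites drops out and `(P ⋄ π) ⋄ Q` becomes `P ⋄ [π, Q]_B`.
  have key := ins_ins (multiLin_ofWord (R.incl P).1) (multiLin_ofWord (R.incl Q).1)
    (multiLin_ofWord R.hemi.1) (supported_ofWord hn _) (supported_ofWord (by norm_num) _)
    (pow_apply_comm R.sumTwist (n - 1) 1) (fun X => ofWord_map (cochain_pow R.hemi (n - 1)) X)
    (fun X => ofWord_map (cochain_pow (R.incl Q) 1) X) (word z)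
  have hPQ : ∀ X, ins k (R.sumTwist ^ (n - 1)) (ofWord (R.incl Q).1) X (ofWord (R.incl P).1) = 0 :=
    fun X => ins_eq_zero _ _ _ fun a b c => R.ofWord_incl_ofWord_incl P Q a b c
  simp only [hPQ, ins_zero, smul_zero, sub_zero] at key
  have key₂ : ins k (R.sumTwist ^ (n - 1)) (ofWord (R.incl Q).1) (word z)
      (fun a => ins k (R.sumTwist ^ 1) (ofWord R.hemi.1) a (ofWord (R.incl P).1))
      = diamondAux R.sumTwist (n := n + 1) (show N + 1 = m + (n + 1) by omega) (R.incl P).1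
        piQ.1 z := by
    rw [key, diamondAux_apply _ _ (by omega)]
    have : R.sumTwist ^ (n + 1 - 1) = (R.sumTwist ^ 1) ∘ₗ (R.sumTwist ^ (n - 1)) := by
      rw [← Module.End.mul_eq_comp, ← pow_add]
      congr 1
      omega
    rw [this]
    congr 1
    funext Y
    rw [hpiQ, ofWord_balavoine _ _ (by norm_num) hn, mul_comm]
  have key₃ := diamondAux_apply R.sumTwist (n := m + 1) (show N + 1 = n + (m + 1) by omega)
    (by omega) (R.incl Q).1 piP.1 z
  have s : (-1 : k) ^ (m - 1) * (-1 : k) ^ (m - 1) = 1 := by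
    rw [← mul_pow]; simp
  have s' : (-1 : k) ^ (m - 1) * (-1 : k) ^ m = -1 := by
    obtain ⟨m, rfl⟩ : ∃ c, m = c + 1 := ⟨m - 1, by omega⟩
    rw [Nat.add_sub_cancel] at s ⊢
    rw [pow_succ, ← mul_assoc, s, one_mul]
  have s'' : (-1 : k) ^ (m - 1) * (-1 : k) ^ (m * (n - 1)) = -(-1 : k) ^ (m * n) := by
    obtain ⟨m, rfl⟩ : ∃ c, m = c + 1 := ⟨m - 1, by omega⟩
    obtain ⟨n, rfl⟩ : ∃ c, n = c + 1 := ⟨n - 1, by omega⟩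
    rw [Nat.add_sub_cancel, Nat.add_sub_cancel, ← pow_add, neg_neg_one_pow]
    refine neg_one_pow_congr ?_
    simp only [Nat.even_add, Nat.even_mul, Nat.not_even_one]
    tauto
  rw [d₀, ← ofWord_word, ofWord_balavoine _ _ (by omega) hn, ← key₃, wA, ins_add, ins_smul, key₂,
    Prod.smul_fst, Prod.fst_sub, Prod.fst_add, Prod.smul_fst, Prod.smul_fst,
    R.ins_ins_hemi_fst hm hn, R.diamondAux_incl_balavoine hn hN P Q v,
    R.diamondAux_incl_balavoine hm (hN.trans (Nat.add_comm m n)) Q P v,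
    R.bracketSum_eq_unsh hN P Q v, Nat.add_sub_cancel]
  simp only [smul_add, smul_sub, smul_smul, s', s'', s, smul_neg, neg_smul, one_smul]
  abel

end Representation

end Explicit

/-! ### Assembling the graded Lie algebra. -/

section Graded

variable {k g V : Type*} [Field k] [CharZero k] [AddCommGroup g] [Module k g] [AddCommGroup V]
  [Module k V] {L : HomLieAlgebra k g} (R : Representation L V)

namespace Representation

theorem insOp_incl_injective {n : ℕ} (hn : 1 ≤ n) {P Q : Cochain R.twist L.twist n}
    (h : insOp (R.incl P) = insOp (R.incl Q)) : P = Q :=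
  R.incl_injective (insOp_injective hn h)

theorem insOp_restr_derived {m n N : ℕ} (hN : N = m + n) (hm : 1 ≤ m) (hn : 1 ≤ n)
    (P : Cochain R.twist L.twist m) (Q : Cochain R.twist L.twist n) :
    insOp (R.incl (R.restr (R.derived hN P Q)))
      = derivedComm k (insOp R.hemi) (m - 1) (n - 1) (insOp (R.incl P)) (insOp (R.incl Q)) := by
  rw [R.incl_restr_derived, R.insOp_derived hN hm hn]

/-- The derived bracket `C^m(V_β, g_α) × C^n(V_β, g_α) → C^{m+n}(V_β, g_α)`. -/
def derivedBracket (m n : ℕ+) : Cochain R.twist L.twist m →ₗ[k] Cochain R.twist L.twist n →ₗ[k]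
    Cochain R.twist L.twist (m + n : ℕ+) :=
  -- Bilinearity is checked on operators, where the derived bracket is visibly bilinear, and pulled
  -- back by injectivity.
  LinearMap.mk₂ k (fun P Q => R.restr (R.derived (PNat.add_coe m n) P Q))
    (fun P P' Q => R.insOp_incl_injective (m + n).pos (by
      simp only [incl_add, insOp_add, R.insOp_restr_derived _ m.pos n.pos]
      exact derivedComm_add_left ..))
    (fun c P Q => R.insOp_incl_injective (m + n).pos (by
      simp only [incl_smul, insOp_smul, R.insOp_restr_derived _ m.pos n.pos]
      exact derivedComm_smul_left ..))
    (fun P Q Q' => R.insOp_incl_injective (m + n).pos (by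
      simp only [incl_add, insOp_add, R.insOp_restr_derived _ m.pos n.pos]
      exact derivedComm_add_right ..))
    (fun c P Q => R.insOp_incl_injective (m + n).pos (by
      simp only [incl_smul, insOp_smul, R.insOp_restr_derived _ m.pos n.pos]
      exact derivedComm_smul_right ..))

theorem insOp_derivedBracket (m n : ℕ+) (P : Cochain R.twist L.twist m)
    (Q : Cochain R.twist L.twist n) :
    insOp (R.incl (R.derivedBracket m n P Q)) = derivedComm k (insOp R.hemi) (m - 1) (n - 1)
      (insOp (R.incl P)) (insOp (R.incl Q)) :=
  R.insOp_restr_derived _ m.pos n.pos P Q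

/-- The element of `⨁_{n ≥ 1} C^n(V_β, g_α)` whose only component is `P`, in degree `n`. -/
abbrev place (n : ℕ+) (P : Cochain R.twist L.twist n) :
    ⨁ n : ℕ+, Cochain R.twist L.twist n :=
  DirectSum.lof k ℕ+ (fun n : ℕ+ => Cochain R.twist L.twist n) n P

/-- The derived bracket on `⨁_{n ≥ 1} C^n(V_β, g_α)`. -/
def totalBracket : (⨁ n : ℕ+, Cochain R.twist L.twist n) →ₗ[k]
    (⨁ n : ℕ+, Cochain R.twist L.twist n) →ₗ[k] ⨁ n : ℕ+, Cochain R.twist L.twist n :=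
  DirectSum.toModule k ℕ+ _ fun m => (DirectSum.toModule k ℕ+ _ fun n =>
    ((R.derivedBracket m n).compr₂
      (DirectSum.lof k ℕ+ (fun n : ℕ+ => Cochain R.twist L.twist n) (m + n))).flip).flip

theorem totalBracket_place (m n : ℕ+) (P : Cochain R.twist L.twist m)
    (Q : Cochain R.twist L.twist n) :
    R.totalBracket (R.place m P) (R.place n Q) = R.place (m + n) (R.derivedBracket m n P Q) := by
  simp only [totalBracket, place, DirectSum.toModule_lof, LinearMap.flip_apply]
  rfl

/-- Degrees such as `m + (n + r)` and `(m + n) + r` index different types. All insertion operators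
live in one algebra whatever the arity, so identities can be compared there. -/
theorem place_eq {N N' : ℕ+} (h : N = N') {P : Cochain R.twist L.twist N}
    {P' : Cochain R.twist L.twist N'} (e : insOp (R.incl P) = insOp (R.incl P')) :
    R.place N P = R.place N' P' := by
  subst h
  rw [R.insOp_incl_injective N.pos e]

theorem exists_place_eq {N N' : ℕ+} (h : N = N') (P : Cochain R.twist L.twist N) :
    ∃ P' : Cochain R.twist L.twist N', R.place N P = R.place N' P' ∧
      insOp (R.incl P) = insOp (R.incl P') := by
  subst h
  exact ⟨P, rfl, rfl⟩

theorem insOp_incl_add_smul {N : ℕ} (T T' : Cochain R.twist L.twist N) (c : k) :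
    insOp (R.incl (T + c • T')) = insOp (R.incl T) + c • insOp (R.incl T') := by
  rw [incl_add, insOp_add, incl_smul, insOp_smul]

theorem place_add_smul {N : ℕ+} (T T' : Cochain R.twist L.twist N) (c : k) :
    R.place N (T + c • T') = R.place N T + c • R.place N T' :=
  (map_add _ _ _).trans (congrArg _ (map_smul _ _ _))

theorem totalBracket_skew (m n : ℕ+) (P : Cochain R.twist L.twist m)
    (Q : Cochain R.twist L.twist n) :
    R.totalBracket (R.place m P) (R.place n Q)
      = -((-1 : k) ^ (m * n : ℕ) • R.totalBracket (R.place n Q) (R.place m P)) := by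
  obtain ⟨S, hS, eS⟩ := R.exists_place_eq (add_comm n m) (R.derivedBracket n m Q P)
  have e : insOp (R.incl (R.derivedBracket m n P Q))
      = insOp (R.incl ((-(-1 : k) ^ (m * n : ℕ)) • S)) := by
    rw [incl_smul, insOp_smul, ← eS, insOp_derivedBracket, insOp_derivedBracket]
    refine (derivedComm_skew (k := k) _ _ (R.insOp_incl_mul m.pos n.pos P Q)).trans ?_
    rw [show (m : ℕ) - 1 + 1 = m from Nat.sub_add_cancel m.pos,
      show (n : ℕ) - 1 + 1 = n from Nat.sub_add_cancel n.pos]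
    exact (neg_smul ((-1 : k) ^ (m * n : ℕ))
      (derivedComm k (insOp R.hemi) (n - 1) (m - 1) (insOp (R.incl Q)) (insOp (R.incl P)))).symm
  rw [totalBracket_place, totalBracket_place, hS]
  exact (R.place_eq rfl e).trans ((map_smul _ _ _).trans (neg_smul ((-1 : k) ^ (m * n : ℕ))
    (R.place (m + n) S)))

theorem totalBracket_jacobi (m n r : ℕ+) (P : Cochain R.twist L.twist m)
    (Q : Cochain R.twist L.twist n) (S : Cochain R.twist L.twist r) :
    R.totalBracket (R.place m P) (R.totalBracket (R.place n Q) (R.place r S))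
      = R.totalBracket (R.totalBracket (R.place m P) (R.place n Q)) (R.place r S)
        + (-1 : k) ^ (m * n : ℕ) •
          R.totalBracket (R.place n Q) (R.totalBracket (R.place m P) (R.place r S)) := by
  simp only [totalBracket_place]
  obtain ⟨T, hT, eT⟩ := R.exists_place_eq (add_assoc m n r)
    (R.derivedBracket (m + n) r (R.derivedBracket m n P Q) S)
  obtain ⟨T', hT', eT'⟩ := R.exists_place_eq (add_left_comm n m r)
    (R.derivedBracket n (m + r) Q (R.derivedBracket m r P S))
  rw [hT, hT', ← place_add_smul]
  refine R.place_eq rfl ?_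
  have degree_add (a b : ℕ+) : ((a + b : ℕ+) : ℕ) - 1 = a - 1 + (b - 1) + 1 := by
    have := a.pos
    have := b.pos
    rw [PNat.add_coe]
    omega
  rw [insOp_incl_add_smul, ← eT, ← eT', insOp_derivedBracket, insOp_derivedBracket,
    insOp_derivedBracket, insOp_derivedBracket, insOp_derivedBracket, insOp_derivedBracket,
    degree_add, degree_add, degree_add]
  refine (derivedComm_jacobi (k := k) R.insOp_hemi_mul_self _ _ _ _ _ _).trans ?_
  rw [show (m : ℕ) - 1 + 1 = m from Nat.sub_add_cancel m.pos,
    show (n : ℕ) - 1 + 1 = n from Nat.sub_add_cancel n.pos]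

/-- The graded Lie algebra `⨁_{n ≥ 1} C^n(V_β, g_α)`. -/
def gradedLieAlgebra : GradedLieAlgebra k fun n : ℕ+ => Cochain R.twist L.twist n where
  bracket := R.totalBracket
  degree m n P Q := ⟨R.derivedBracket m n P Q, R.totalBracket_place m n P Q⟩
  skew := R.totalBracket_skew
  jacobi := R.totalBracket_jacobi

end Representation

end Graded
end HomLie

theorem mainTheorem2 {k g V : Type*} [Field k] [CharZero k]
    [AddCommGroup g] [Module k g] [AddCommGroup V] [Module k V]
    (L : HomLie.HomLieAlgebra k g) (R : HomLie.Representation L V) :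
    ∃ G : HomLie.GradedLieAlgebra k (fun n : ℕ+ => HomLie.Cochain R.twist L.twist n),
      ∀ (m n : ℕ+) (P : HomLie.Cochain R.twist L.twist m)
        (Q : HomLie.Cochain R.twist L.twist n),
        ∃ S : HomLie.Cochain R.twist L.twist (m + n : ℕ+),
          G.bracket
              (DirectSum.lof k ℕ+ (fun n : ℕ+ => HomLie.Cochain R.twist L.twist n) m P)
              (DirectSum.lof k ℕ+ (fun n : ℕ+ => HomLie.Cochain R.twist L.twist n) n Q)
            = DirectSum.lof k ℕ+ (fun n : ℕ+ => HomLie.Cochain R.twist L.twist n) (m + n) S ∧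
          R.incl S = R.derived (PNat.add_coe m n) P Q ∧
          ∀ v : Fin (m + n : ℕ+) → V,
            S.1 v = R.halfSum (PNat.add_coe m n) P Q v
              - (-1 : k) ^ (m * n : ℕ) •
                R.halfSum ((PNat.add_coe m n).trans (Nat.add_comm m n)) Q P v
              + R.bracketSum (PNat.add_coe m n) P Q v :=
  ⟨R.gradedLieAlgebra, fun m n P Q => ⟨R.derivedBracket m n P Q, R.totalBracket_place m n P Q,
    R.incl_restr_derived _ P Q, fun v => R.derived_fst _ m.pos n.pos P Q v⟩⟩
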